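/- Let $d\in\mathbb N$ and let $\mathbb X$ be the space of continuous paths $x:[0,1]\to\mathbb R^d$ with $x(0)=0$ that have a derivative $\dot x\in L^2([0,1];\mathbb R^d)$, i.e. $x_t=\int_0^t\dot x_r\,dr$, with norm $\|x\|_{\mathbb X}=\|\dot x\|_{L^2}$. Let $\sigma_a,\sigma_A>0$ and $\sigma_b\ge 0$. Let $\varphi:\mathbb R\to\mathbb R$ be linearly bounded ($|\varphi(u)|\le M(1+|u|)$ for some $M>0$) and absolutely continuous (on every compact interval) with exponentially bounded derivative ($|\varphi'(u)|\le Ce^{c|u|}$ for almost every $u$, for some constants $C,c$). For a positive semidefinite $2\times2$ matrix $\Sigma$ put $V_\varphi(\Sigma)=\mathbb E[\varphi(Z_1)\varphi(Z_2)]$ with $(Z_1,Z_2)\sim\mathcal N(0,\Sigma)$. For a partition $\mathcal D=\{0=t_0<\dots<t_N=1\}$ with mesh $|\mathcal D|=\max_m (t_{m+1}-t_m)$ and $x,y\in\mathbb X$, the discrete kernels on $\mathcal D\times\mathcal D$ are given by $\mathcal K^{x,y}_{\mathcal D\times\mathcal D}(0,t_n)=\mathcal K^{x,y}_{\mathcal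 D\times\mathcal D}(t_m,0)=\sigma_a^2$ and $$\mathcal K^{x,y}_{\mathcal D\times\mathcal D}(t_{m+1},t_{n+1})=\mathcal K^{x,y}_{\mathcal D\times\mathcal D}(t_m,t_{n+1})+\mathcal K^{x,y}_{\mathcal D\times\mathcal D}(t_{m+1},t_n)-\mathcal K^{x,y}_{\mathcal D\times\mathcal D}(t_m,t_n)+\big(\sigma_A^2V_\varphi(\Sigma^{x,y}_{\mathcal D\times\mathcal D}(t_m,t_n))+\sigma_b^2\big)\langle x_{t_{m+1}}-x_{t_m},\,y_{t_{n+1}}-y_{t_n}\rangle,$$ $$\Sigma^{x,y}_{\mathcal D\times\mathcal D}(s,t)=\begin{pmatrix}\mathcal K^{x,x}_{\mathcal D\times\mathcal D}(s,s)&\mathcal K^{x,y}_{\mathcal D\times\mathcal D}(s,t)\\ \mathcal K^{x,y}_{\mathcal D\times\mathcal D}(s,t)&\mathcal K^{y,y}_{\mathcal D\times\mathcal D}(t,t)\end{pmatrix}.$$ They are extended to $[0,1]^2$ by integral interpolation, $$\mathcal K^{x,y}_{\mathcal D\times\mathcal D}(s,t)=\sigma_a^2+\int_0^s\!\int_0^t\big(\sigma_A^2V_\varphi(\tilde\Sigma^{x,y}_{\mathcal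 D\times\mathcal D}(\eta,\tau))+\sigma_b^2\big)\langle\dot x_\eta,\dot y_\tau\rangle\,d\tau\,d\eta,$$ where $\tilde\Sigma^{x,y}_{\mathcal D\times\mathcal D}(\eta,\tau)=\Sigma^{x,y}_{\mathcal D\times\mathcal D}(t_m,t_n)$ for $(\eta,\tau)\in[t_m,t_{m+1})\times[t_n,t_{n+1})$. Theorem. There are functions $\mathcal K^{x,y}_\varphi:[0,1]^2\to\mathbb R$, $x,y\in\mathbb X$, such that the following hold. (i) For all $x,y\in\mathbb X$, $\mathcal K^{x,y}_\varphi$ is continuous, the matrices $$\Sigma^{x,y}_\varphi(s,t)=\begin{pmatrix}\mathcal K^{x,x}_\varphi(s,s)&\mathcal K^{x,y}_\varphi(s,t)\\ \mathcal K^{x,y}_\varphi(s,t)&\mathcal K^{y,y}_\varphi(t,t)\end{pmatrix}$$ are positive semidefinite, and $\mathcal K_\varphi^{x,y}$ solves the Goursat problem $$\partial_s\partial_t\mathcal K^{x,y}_\varphi=\big[\sigma_A^2V_\varphi(\Sigma^{x,y}_\varphi)+\sigma_b^2\big]\langle\dot x_s,\dot y_t\rangle,\qquad \mathcal K^{x,y}_\varphi(s,0)=\mathcal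 K^{x,y}_\varphi(0,t)=\sigma_a^2 .$$ The equation holds in integrated form: the right-hand side is integrable on $[0,1]^2$ and for all $s,t\in[0,1]$ $$\mathcal K^{x,y}_\varphi(s,t)=\sigma_a^2+\int_0^s\!\int_0^t\big[\sigma_A^2V_\varphi(\Sigma^{x,y}_\varphi(\eta,\tau))+\sigma_b^2\big]\langle\dot x_\eta,\dot y_\tau\rangle\,d\tau\,d\eta .$$ It also holds almost everywhere: for almost every $t$ the derivative $\partial_t\mathcal K^{x,y}_\varphi(s,t)$ exists for all $s\in[0,1]$, and for almost every $t$ and then almost every $s$ its $s$-derivative exists and equals the right-hand side. (ii) All interpolated kernels $\mathcal K^{x,y}_{\mathcal D\times\mathcal D}$ are continuous on $[0,1]^2$, and for every sequence $(\mathcal D_M)$ of partitions of $[0,1]$ with $|\mathcal D_M|\to0$ and all $x,y\in\mathbb X$, $\mathcal K^{x,y}_{\mathcal D_M\times\mathcal D_M}\to\mathcal K^{x,y}_\varphi$ uniformly on $[0,1]^2$. In particular the limit does not depend on the sequence. The convergence is uniform for $x,y$ in bounded sets of $\mathbb X$. (iii) For every $r$ there is a constant $C$, depending only on $r,d,\varphi,\sigma_a,\sigma_A,\sigma_b$,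 such that for every partition $\mathcal D$ and all $x,y\in\mathbb X$ with $\|x\|_{\mathbb X},\|y\|_{\mathbb X}\le r$, $$\sup_{s,t\in[0,1]}\big|\mathcal K^{x,y}_{\mathcal D\times\mathcal D}(s,t)-\mathcal K^{x,y}_\varphi(s,t)\big|\le C\sqrt{|\mathcal D|}.$$ -/

import Mathlib

open MeasureTheory ProbabilityTheory Set Filter Topology

namespace NeuralSigKernel

/-- Lebesgue measure on the unit interval, as a measure on the real line. -/
noncomputable abbrev unitVol : Measure ℝ := volume.restrict (Icc (0 : ℝ) 1)

/-- The space of continuous paths `x : [0,1] → ℝ^d` with `x 0 = 0` which have a square integrable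
derivative, that is, `x t = ∫_0^t v` for some `v` in `L²([0,1]; ℝ^d)`. -/
structure SobolevPath (d : ℕ) where
  /-- the underlying continuous function on `[0,1]` -/
  toFun : C(unitInterval, EuclideanSpace ℝ (Fin d))
  map_zero : toFun 0 = 0
  exists_velocity : ∃ v : Lp (EuclideanSpace ℝ (Fin d)) 2 unitVol,
    ∀ t : unitInterval, toFun t = ∫ r in (0 : ℝ)..(t : ℝ), v r

/-- The derivative of a path, an element of `L²([0,1]; ℝ^d)` (it is unique as such). -/
noncomputable def SobolevPath.velocity {d : ℕ} (x : SobolevPath d) :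
    Lp (EuclideanSpace ℝ (Fin d)) 2 unitVol :=
  x.exists_velocity.choose

/-- The norm of a path is the `L²` norm of its derivative. -/
noncomputable instance {d : ℕ} : Norm (SobolevPath d) := ⟨fun x => ‖x.velocity‖⟩

/-- A partition `0 = t_0 < t_1 < ⋯ < t_size = 1`. The values of `pt` beyond `size` play no role. -/
structure UnitPartition where
  size : ℕ
  pt : ℕ → unitInterval
  pt_zero : pt 0 = 0
  pt_size : pt size = 1
  pt_lt : ∀ i, i < size → pt i < pt (i + 1)

/-- The mesh, i.e. the largest length of an interval of the partition. -/
noncomputable def UnitPartition.mesh (D : UnitPartition) : ℝ :=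
  ⨆ i : Fin D.size, ((D.pt (i + 1) : ℝ) - (D.pt i : ℝ))

/-- The index `m ≤ size` with `s ∈ [t_m, t_{m+1})`; it is `size` for `s = 1`. -/
noncomputable def UnitPartition.idx (D : UnitPartition) (s : ℝ) : ℕ :=
  open Classical in Nat.findGreatest (fun i => (D.pt i : ℝ) ≤ s) D.size

/-- Linear growth. -/
def LinearlyBounded (φ : ℝ → ℝ) : Prop :=
  ∃ M : ℝ, 0 < M ∧ ∀ u, |φ u| ≤ M * (1 + |u|)

/-- `φ` is absolutely continuous (on every compact interval), and its derivative, which then exists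
almost everywhere, is exponentially bounded. -/
def ACWithExpBoundedDeriv (φ : ℝ → ℝ) : Prop :=
  (∀ a b : ℝ, AbsolutelyContinuousOnInterval φ a b) ∧
    ∃ C c : ℝ, ∀ᵐ u : ℝ, |deriv φ u| ≤ C * Real.exp (c * |u|)

/-- `V_φ(S) = 𝔼[φ(Z₁) φ(Z₂)]` for `(Z₁, Z₂) ∼ N(0, S)`. -/
noncomputable def V (φ : ℝ → ℝ) (S : Matrix (Fin 2) (Fin 2) ℝ) : ℝ :=
  ∫ z, φ (z 0) * φ (z 1) ∂(multivariateGaussian 0 S)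

/-- The discrete kernel `K^{x,y}_{D×D}(s_m, t_n)`, as a function of the indices `m` and `n`. -/
noncomputable def discreteKernel (φ : ℝ → ℝ) (σa σA σb : ℝ) {d : ℕ} (D : UnitPartition) :
    SobolevPath d → SobolevPath d → ℕ → ℕ → ℝ
  | _, _, 0, _ => σa ^ 2
  | _, _, _ + 1, 0 => σa ^ 2
  | x, y, m + 1, n + 1 =>
      discreteKernel φ σa σA σb D x y m (n + 1) + discreteKernel φ σa σA σb D x y (m + 1) n
        - discreteKernel φ σa σA σb D x y m n
        + (σA ^ 2 * V φ !![discreteKernel φ σa σA σb D x x m m,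
                            discreteKernel φ σa σA σb D x y m n;
                            discreteKernel φ σa σA σb D x y m n,
                            discreteKernel φ σa σA σb D y y n n] + σb ^ 2)
          * inner ℝ (x.toFun (D.pt (m + 1)) - x.toFun (D.pt m))
              (y.toFun (D.pt (n + 1)) - y.toFun (D.pt n))
termination_by _ _ m n => (max m n, m + n)
decreasing_by all_goals simp only [Prod.lex_def]; omega

/-- For a family `K^{x,y}(s,t)`, the matrix with rows `(K^{x,x}(s,s), K^{x,y}(s,t))` and
`(K^{x,y}(s,t), K^{y,y}(t,t))`. -/
def covMat {d : ℕ} (K : SobolevPath d → SobolevPath d → ℝ → ℝ → ℝ) (x y : SobolevPath d) (s t : ℝ) :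
    Matrix (Fin 2) (Fin 2) ℝ :=
  !![K x x s s, K x y s t; K x y s t, K y y t t]

/-- The density `[σ_A² V_φ(Σ^{x,y}(s,t)) + σ_b²] ⟨x'(s), y'(t)⟩`, where `Σ` comes from `K`. -/
noncomputable def density (φ : ℝ → ℝ) (σA σb : ℝ) {d : ℕ} (K : SobolevPath d → SobolevPath d → ℝ → ℝ → ℝ)
    (x y : SobolevPath d) (s t : ℝ) : ℝ :=
  (σA ^ 2 * V φ (covMat K x y s t) + σb ^ 2) * inner ℝ (x.velocity s) (y.velocity t)

/-- The piecewise constant interpolation of the discrete kernel: its value is the one at `(t_m, t_n)`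
for `(s, t) ∈ [t_m, t_{m+1}) × [t_n, t_{n+1})`. -/
noncomputable def stepKernel (φ : ℝ → ℝ) (σa σA σb : ℝ) {d : ℕ} (D : UnitPartition)
    (x y : SobolevPath d) (s t : ℝ) : ℝ :=
  discreteKernel φ σa σA σb D x y (D.idx s) (D.idx t)

/-- The integral interpolation of the discrete kernel: the continuous function which on each cell
`[t_m, t_{m+1}) × [t_n, t_{n+1})` satisfies
`K(s,t) = K(t_m,t) + K(s,t_n) - K(t_m,t_n)
  + ∫_{t_m}^s ∫_{t_n}^t (σ_A² V_φ(Σ(t_m,t_n)) + σ_b²) ⟨x'(η), y'(τ)⟩ dτ dη`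
and which is `σ_a²` for `s = 0` or `t = 0`. Summed over the cells this is one double integral, in
which `Σ` is interpolated piecewise constantly. -/
noncomputable def interpKernel (φ : ℝ → ℝ) (σa σA σb : ℝ) {d : ℕ} (D : UnitPartition)
    (x y : SobolevPath d) (s t : ℝ) : ℝ :=
  σa ^ 2 + ∫ η in (0 : ℝ)..s, ∫ τ in (0 : ℝ)..t,
    density φ σA σb (stepKernel φ σa σA σb D) x y η τ

/-- The family `K` solves, for the pair `x, y`, the Goursat problem
`∂_s ∂_t K^{x,y} = [σ_A² V_φ(Σ^{x,y}) + σ_b²] ⟨x'(s), y'(t)⟩`,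
`K^{x,y}(s,0) = K^{x,y}(0,t) = σ_a²` on `[0,1]²`. As `x'` and `y'` are merely square integrable,
the equation is understood in integrated form (`integral_eq`) and almost everywhere
(`mixed_deriv`). -/
structure SolvesGoursat (φ : ℝ → ℝ) (σa σA σb : ℝ) {d : ℕ} (K : SobolevPath d → SobolevPath d → ℝ → ℝ → ℝ)
    (x y : SobolevPath d) : Prop where
  continuousOn : ContinuousOn (fun p : ℝ × ℝ => K x y p.1 p.2) (Icc 0 1 ×ˢ Icc 0 1)
  posSemidef : ∀ s ∈ Icc (0 : ℝ) 1, ∀ t ∈ Icc (0 : ℝ) 1, (covMat K x y s t).PosSemidef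
  left_zero : ∀ t ∈ Icc (0 : ℝ) 1, K x y 0 t = σa ^ 2
  right_zero : ∀ s ∈ Icc (0 : ℝ) 1, K x y s 0 = σa ^ 2
  integrable : Integrable (fun p : ℝ × ℝ => density φ σA σb K x y p.1 p.2) (unitVol.prod unitVol)
  integral_eq : ∀ s ∈ Icc (0 : ℝ) 1, ∀ t ∈ Icc (0 : ℝ) 1,
    K x y s t = σa ^ 2 + ∫ η in (0 : ℝ)..s, ∫ τ in (0 : ℝ)..t, density φ σA σb K x y η τ
  mixed_deriv : ∃ L : ℝ → ℝ → ℝ,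
    (∀ᵐ t ∂unitVol, ∀ s ∈ Icc (0 : ℝ) 1, HasDerivAt (fun τ => K x y s τ) (L s t) t) ∧
    (∀ᵐ t ∂unitVol, ∀ᵐ s ∂unitVol,
      HasDerivAt (fun η => L η t) (density φ σA σb K x y s t) s)

end NeuralSigKernel

/-!
The kernels `K^{x,y}` are covariances of Gaussian families, and the argument rests on this positivity
and on the regularity of `V_φ` on such covariances.

*Regularity of `V_φ`.* On covariance matrices `!![a, c; c, b]` whose variances `a`, `b` are
bounded and bounded away from zero, `V_φ` is Lipschitz (`exists_abs_V_sub_le`), although `φ` is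
only absolutely continuous. Changing the variances amounts to scaling the two Gaussian variables.
For two correlations `r' ≤ r`, there are Gaussian variables `X, X', Y, Y'` of variance one such
that `(X, Y)` and `(X', Y')` have correlation `r`, `(X, Y')` and `(X', Y)` have correlation `r'`,
and `𝔼|X - X'|² = 𝔼|Y - Y'|² = 2 (r - r')`. Then
`2 (𝔼[φ(X) φ(Y)] - 𝔼[φ(X) φ(Y')]) = 𝔼[(φ(X) - φ(X')) (φ(Y) - φ(Y'))]`
is a product of two increments of order `√(r - r')`, hence of order `r - r'`; no Gaussian
integration by parts is needed.

*Positivity.* The discrete kernel minus `σ_a²` is a positive semidefinite kernel in the pair of a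
path and a time, by induction over the time steps and the Schur product theorem
(`posSemidef_discreteKernel_sub`). So all matrices that occur are covariance matrices with
variances at least `σ_a² > 0`, which is where the Lipschitz estimate applies.

The rest is a Grönwall argument. The piecewise constant kernel agrees with the interpolated one at
the grid points (`stepKernel_eq_interpKernel`), and the interpolated kernel is Hölder continuous
of exponent `1/2`, since the paths have square integrable velocities; so the two differ by
`O(√mesh)`. In the norm with weight `e^{-l max(s,t)}` and large `l`, the Cauchy-Schwarz inequality
makes the integral operator a contraction (`abs_pairIntegral_le`, `le_of_contraction`). This
bounds the variances uniformly over all partitions (`exists_stepKernel_le`), and bounds the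
difference of the kernels of two partitions by the square roots of their meshes
(`exists_abs_interpKernel_sub_le`). Hence the kernels of the uniform partitions form a Cauchy
sequence, whose limit has the asserted rate, admissible covariance matrices, and solves the
integrated equation (`limitKernel_eq`). The equation almost everywhere follows by Lebesgue
differentiation: the points where `∫ y'` and `∫ ‖y'‖` are differentiable are good for the
primitives of all products of `y'` with continuous functions (`hasDerivAt_integral_clm_apply`).
-/

namespace NeuralSigKernel

/-! ### Gaussian expectations and Gram matrices -/

section Gaussian
variable {E : Type*} [NormedAddCommGroup E] [InnerProductSpace ℝ E] [FiniteDimensional ℝ E]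
  [MeasurableSpace E] [BorelSpace E]

open scoped MatrixOrder in
/-- A positive semidefinite matrix is a Gram matrix. -/
lemma exists_factor_of_posSemidef {ι : Type*} [Fintype ι] [DecidableEq ι]
    {S : Matrix ι ι ℝ} (hS : S.PosSemidef) :
    ∃ p : ι → EuclideanSpace ℝ ι, ∀ i j, inner ℝ (p i) (p j) = S i j := by
  obtain ⟨B, hB⟩ := CStarAlgebra.nonneg_iff_eq_star_mul_self.mp hS.nonneg
  refine ⟨fun i => WithLp.toLp 2 fun k => B k i, fun i j => ?_⟩
  rw [hB]
  simp [PiLp.inner_apply, Matrix.mul_apply, Matrix.star_apply, mul_comm]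

/-- The law of `(⟨p, Z⟩, ⟨q, Z⟩)` for a standard Gaussian vector `Z` is the centred Gaussian law
whose covariance is the Gram matrix of `p` and `q`. -/
lemma map_inner_stdGaussian (p q : E) :
    (stdGaussian E).map (fun z => (!₂[inner ℝ p z, inner ℝ q z] : EuclideanSpace ℝ (Fin 2))) =
      multivariateGaussian 0 !![inner ℝ p p, inner ℝ p q; inner ℝ p q, inner ℝ q q] := by
  have hS : (!![inner ℝ p p, inner ℝ p q; inner ℝ p q, inner ℝ q q] :
      Matrix (Fin 2) (Fin 2) ℝ).PosSemidef := by
    have h : (!![inner ℝ p p, inner ℝ p q; inner ℝ p q, inner ℝ q q] :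
        Matrix (Fin 2) (Fin 2) ℝ) = Matrix.gram ℝ ![p, q] := by
      ext i j
      fin_cases i <;> fin_cases j <;> simp [Matrix.gram, real_inner_comm]
    rw [h]
    exact Matrix.posSemidef_gram ℝ ![p, q]
  have hm : Measurable (fun z => (!₂[inner ℝ p z, inner ℝ q z] : EuclideanSpace ℝ (Fin 2))) := by
    apply Continuous.measurable
    fun_prop
  have : IsProbabilityMeasure ((stdGaussian E).map
      (fun z => (!₂[inner ℝ p z, inner ℝ q z] : EuclideanSpace ℝ (Fin 2)))) :=
    Measure.isProbabilityMeasure_map hm.aemeasurable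
  apply Measure.ext_of_charFun
  ext t
  rw [charFun_multivariateGaussian hS, charFun_apply, integral_map hm.aemeasurable
    (by apply Continuous.aestronglyMeasurable; fun_prop)]
  have h1 := charFun_stdGaussian (E := E) (t 0 • p + t 1 • q)
  rw [charFun_apply] at h1
  convert h1 using 1
  · refine integral_congr_ae (Eventually.of_forall fun z => ?_)
    simp [PiLp.inner_apply, inner_add_right, inner_smul_right, real_inner_comm, mul_comm]
  · congr 1
    have h2 : ‖t 0 • p + t 1 • q‖ ^ 2 = t 0 * (inner ℝ p p * t 0 + inner ℝ p q * t 1)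
        + t 1 * (inner ℝ p q * t 0 + inner ℝ q q * t 1) := by
      rw [← real_inner_self_eq_norm_sq]
      simp only [inner_add_left, inner_add_right, inner_smul_left, inner_smul_right,
        real_inner_comm q p]
      simp
      ring
    rw [← Complex.ofReal_pow, h2]
    simp [Matrix.mulVec, dotProduct, Fin.sum_univ_two]
    ring

/-- `V φ` on Gram matrices as an expectation over a standard Gaussian vector. -/
lemma V_gram {φ : ℝ → ℝ} (hφ : Continuous φ) (p q : E) :
    V φ !![inner ℝ p p, inner ℝ p q; inner ℝ p q, inner ℝ q q] =
      ∫ z, φ (inner ℝ p z) * φ (inner ℝ q z) ∂(stdGaussian E) := by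
  rw [V, ← map_inner_stdGaussian, integral_map]
  · simp
  · apply Continuous.aemeasurable; fun_prop
  · apply Continuous.aestronglyMeasurable; fun_prop

/-- All exponential moments of the norm of a standard Gaussian vector are finite. -/
lemma integrable_exp_mul_norm (k : ℝ) :
    Integrable (fun z : E => Real.exp (k * ‖z‖)) (stdGaussian E) := by
  obtain ⟨C, hC, hint⟩ := IsGaussian.exists_integrable_exp_sq (stdGaussian E)
  refine (hint.const_mul (Real.exp (k ^ 2 / (4 * C)))).mono'
    (by apply Continuous.aestronglyMeasurable; fun_prop) (Eventually.of_forall fun z => ?_)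
  rw [Real.norm_eq_abs, abs_of_pos (Real.exp_pos _), ← Real.exp_add, Real.exp_le_exp]
  -- Completing the square compares the exponent with that of Fernique's theorem.
  have h : k ^ 2 / (4 * C) + C * ‖z‖ ^ 2 - k * ‖z‖ = (k / (2 * C) - ‖z‖) ^ 2 * C := by
    field_simp
    ring
  nlinarith [mul_nonneg (sq_nonneg (k / (2 * C) - ‖z‖)) hC.le]

end Gaussian

lemma ACWithExpBoundedDeriv.continuous {φ : ℝ → ℝ} (h : ACWithExpBoundedDeriv φ) :
    Continuous φ := by
  rw [continuous_iff_continuousAt]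
  intro x
  have := (h.1 (x - 1) (x + 1)).continuousOn
  rw [uIcc_of_le (by linarith)] at this
  exact this.continuousAt (Icc_mem_nhds (by linarith) (by linarith))

/-- The fundamental theorem of calculus for absolutely continuous functions turns the bound on the
derivative into a local Lipschitz bound. -/
lemma ACWithExpBoundedDeriv.exists_abs_sub_le {φ : ℝ → ℝ} (h : ACWithExpBoundedDeriv φ) :
    ∃ C c : ℝ, 0 ≤ C ∧ 0 ≤ c ∧ ∀ R u v, |u| ≤ R → |v| ≤ R →
      |φ u - φ v| ≤ C * Real.exp (c * R) * |u - v| := by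
  obtain ⟨C, c, hd⟩ := h.2
  refine ⟨|C|, |c|, abs_nonneg _, abs_nonneg _, fun R u v hu hv => ?_⟩
  rw [← (h.1 v u).integral_deriv_eq_sub, ← Real.norm_eq_abs]
  refine intervalIntegral.norm_integral_le_of_norm_le_const_ae ?_
  filter_upwards [hd] with w hw hwm
  have hwR : |w| ≤ R := by
    have := uIoc_subset_uIcc hwm
    rw [mem_uIcc] at this
    rw [abs_le] at *
    rcases this with h | h <;> constructor <;> linarith
  refine hw.trans ((mul_le_mul_of_nonneg_right (le_abs_self C) (Real.exp_pos _).le).trans ?_)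
  gcongr
  exact le_abs_self c

/-! ### Lipschitz continuity of the Gaussian expectation -/

/-- The entries of a covariance matrix `!![a, c; c, b]` whose variances are at least `σ ^ 2`. -/
structure Admissible (σ a b c : ℝ) : Prop where
  left : σ ^ 2 ≤ a
  right : σ ^ 2 ≤ b
  sq_le : c ^ 2 ≤ a * b

lemma Admissible.posSemidef {σ a b c : ℝ} (h : Admissible σ a b c) :
    (!![a, c; c, b] : Matrix (Fin 2) (Fin 2) ℝ).PosSemidef := by
  have ha : 0 ≤ a := (sq_nonneg σ).trans h.left
  have hb : 0 ≤ b := (sq_nonneg σ).trans h.right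
  rw [Matrix.posSemidef_iff_dotProduct_mulVec]
  refine ⟨by ext i j; fin_cases i <;> fin_cases j <;> simp, fun v => ?_⟩
  simp only [dotProduct, Matrix.mulVec, Fin.sum_univ_two, Pi.star_apply, star_trivial]
  simp
  have hc := h.sq_le
  rcases ha.eq_or_lt with h0 | h0
  · have : c = 0 := by
      rw [← h0, zero_mul] at hc
      exact pow_eq_zero_iff two_ne_zero |>.1 (le_antisymm hc (sq_nonneg c))
    rw [← h0, this]
    nlinarith [mul_nonneg hb (sq_nonneg (v 1))]
  · have : 0 ≤ a * (v 0 * (a * v 0 + c * v 1) + v 1 * (c * v 0 + b * v 1)) := by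
      have : a * (v 0 * (a * v 0 + c * v 1) + v 1 * (c * v 0 + b * v 1)) =
        (a * v 0 + c * v 1) ^ 2 + (a * b - c ^ 2) * v 1 ^ 2 := by ring
      rw [this]
      have := mul_nonneg (sub_nonneg.2 hc) (sq_nonneg (v 1))
      positivity
    exact nonneg_of_mul_nonneg_right this h0

section Regularity
variable {φ : ℝ → ℝ} {M C c : ℝ}
variable {E : Type*} [NormedAddCommGroup E] [InnerProductSpace ℝ E]

lemma abs_comp_inner_le (hM : 0 ≤ M) (hlin : ∀ u, |φ u| ≤ M * (1 + |u|)) (R : ℝ) (p z : E)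
    (hp : ‖p‖ ≤ R) : |φ (inner ℝ p z)| ≤ M * Real.exp (R * ‖z‖) := by
  refine (hlin _).trans (mul_le_mul_of_nonneg_left ?_ hM)
  have h1 : |inner ℝ p z| ≤ R * ‖z‖ :=
    (abs_real_inner_le_norm p z).trans (mul_le_mul_of_nonneg_right hp (norm_nonneg _))
  linarith [Real.add_one_le_exp (R * ‖z‖)]

lemma abs_comp_inner_sub_le (hC : 0 ≤ C)
    (hloc : ∀ R u v, |u| ≤ R → |v| ≤ R → |φ u - φ v| ≤ C * Real.exp (c * R) * |u - v|)
    (R : ℝ) (p q z : E) (hp : ‖p‖ ≤ R) (hq : ‖q‖ ≤ R) :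
    |φ (inner ℝ p z) - φ (inner ℝ q z)| ≤ C * ‖p - q‖ * Real.exp ((c * R + 1) * ‖z‖) := by
  have hb : ∀ p : E, ‖p‖ ≤ R → |inner ℝ p z| ≤ R * ‖z‖ := fun p hp =>
    (abs_real_inner_le_norm p z).trans (mul_le_mul_of_nonneg_right hp (norm_nonneg _))
  refine (hloc (R * ‖z‖) _ _ (hb p hp) (hb q hq)).trans ?_
  rw [← inner_sub_left]
  have h1 : |inner ℝ (p - q) z| ≤ ‖p - q‖ * Real.exp ‖z‖ :=
    (abs_real_inner_le_norm _ z).trans (mul_le_mul_of_nonneg_left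
      (by linarith [Real.add_one_le_exp ‖z‖]) (norm_nonneg _))
  calc C * Real.exp (c * (R * ‖z‖)) * |inner ℝ (p - q) z|
      ≤ C * Real.exp (c * (R * ‖z‖)) * (‖p - q‖ * Real.exp ‖z‖) := by gcongr
    _ = _ := by
      rw [show (c * R + 1) * ‖z‖ = c * (R * ‖z‖) + ‖z‖ by ring, Real.exp_add]
      ring

variable [FiniteDimensional ℝ E] [MeasurableSpace E] [BorelSpace E]

lemma integrable_comp_inner_mul (hφ : Continuous φ) (hM : 0 ≤ M)
    (hlin : ∀ u, |φ u| ≤ M * (1 + |u|)) (p q : E) :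
    Integrable (fun z => φ (inner ℝ p z) * φ (inner ℝ q z)) (stdGaussian E) := by
  refine ((integrable_exp_mul_norm (‖p‖ + ‖q‖)).const_mul (M * M)).mono'
    (by apply Continuous.aestronglyMeasurable; fun_prop) (Eventually.of_forall fun z => ?_)
  rw [Real.norm_eq_abs, abs_mul, add_mul, Real.exp_add]
  calc _ ≤ (M * Real.exp (‖p‖ * ‖z‖)) * (M * Real.exp (‖q‖ * ‖z‖)) := by
        gcongr
        · exact abs_comp_inner_le hM hlin _ p z le_rfl
        · exact abs_comp_inner_le hM hlin _ q z le_rfl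
    _ = _ := by ring

/-- The Gaussian expectation realised by any two vectors with the prescribed norms and inner
product. -/
lemma V_eq_integral (hφ : Continuous φ) {a b c : ℝ} (p q : E) (ha : ‖p‖ ^ 2 = a) (hb : ‖q‖ ^ 2 = b)
    (hc : inner ℝ p q = c) :
    V φ !![a, c; c, b] = ∫ z, φ (inner ℝ p z) * φ (inner ℝ q z) ∂(stdGaussian E) := by
  rw [← V_gram hφ, real_inner_self_eq_norm_sq, real_inner_self_eq_norm_sq, ha, hb, hc]

end Regularity

section Lipschitz
variable {φ : ℝ → ℝ} {M C c : ℝ}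

/-- Lipschitz dependence of `V φ` on the correlation. Two correlations `r' ≤ r` are realised by four
unit vectors `X, X', Y, Y'` with `⟪X, Y⟫ = ⟪X', Y'⟫ = r`, `⟪X, Y'⟫ = ⟪X', Y⟫ = r'` and
`‖X - X'‖ ^ 2 = ‖Y - Y'‖ ^ 2 = 2 (r - r')`; twice the difference of the two expectations is then the
expectation of a product of two increments of `φ`, which is of order `r - r'` although each
increment is only of order `√(r - r')`. -/
lemma exists_abs_V_sub_le_correlation (hφ : Continuous φ) (hM : 0 ≤ M)
    (hlin : ∀ u, |φ u| ≤ M * (1 + |u|)) (hC : 0 ≤ C)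
    (hloc : ∀ R u v, |u| ≤ R → |v| ≤ R → |φ u - φ v| ≤ C * Real.exp (c * R) * |u - v|) (R : ℝ) :
    ∃ L, 0 ≤ L ∧ ∀ α β r r', 0 ≤ α → α ≤ R → 0 ≤ β → β ≤ R → |r| ≤ 1 → |r'| ≤ 1 →
      |V φ !![α ^ 2, α * β * r; α * β * r, β ^ 2] - V φ !![α ^ 2, α * β * r'; α * β * r', β ^ 2]|
        ≤ L * |r - r'| := by
  set J := ∫ z, Real.exp ((2 * (c * R + 1)) * ‖z‖) ∂(stdGaussian (EuclideanSpace ℝ (Fin 3)))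
    with hJ
  have hJ0 : 0 ≤ J := integral_nonneg fun z => (Real.exp_pos _).le
  refine ⟨R ^ 2 * C ^ 2 * J, by positivity, ?_⟩
  intro α β r r' hα hαR hβ hβR hr hr'
  wlog hle : r' ≤ r generalizing r r'
  · have := this r' r hr' hr (le_of_not_ge hle)
    rwa [abs_sub_comm, abs_sub_comm r r']
  rw [abs_le] at hr hr'
  obtain ⟨u, hu⟩ : ∃ u, u = √((1 + r') / 2) := ⟨_, rfl⟩
  obtain ⟨v, hv⟩ : ∃ u, u = √((1 - r) / 2) := ⟨_, rfl⟩
  obtain ⟨w, hw⟩ : ∃ u, u = √((r - r') / 2) := ⟨_, rfl⟩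
  have hu2 : u * u = (1 + r') / 2 := by rw [hu]; exact Real.mul_self_sqrt (by linarith)
  have hv2 : v * v = (1 - r) / 2 := by rw [hv]; exact Real.mul_self_sqrt (by linarith)
  have hw2 : w * w = (r - r') / 2 := by rw [hw]; exact Real.mul_self_sqrt (by linarith)
  have hw0 : 0 ≤ w := hw ▸ Real.sqrt_nonneg _
  -- `p, p', q, q'` are `α X, α X', β Y, β Y'`.
  let p : EuclideanSpace ℝ (Fin 3) := !₂[α * u, α * v, α * w]
  let p' : EuclideanSpace ℝ (Fin 3) := !₂[α * u, α * v, -(α * w)]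
  let q : EuclideanSpace ℝ (Fin 3) := !₂[β * u, -(β * v), β * w]
  let q' : EuclideanSpace ℝ (Fin 3) := !₂[β * u, -(β * v), -(β * w)]
  have e1 : ‖p‖ ^ 2 = α ^ 2 := by
    simp [p, EuclideanSpace.real_norm_sq_eq, Fin.sum_univ_three]
    linear_combination α ^ 2 * (hu2 + hv2 + hw2)
  have e2 : ‖p'‖ ^ 2 = α ^ 2 := by
    simp [p', EuclideanSpace.real_norm_sq_eq, Fin.sum_univ_three]
    linear_combination α ^ 2 * (hu2 + hv2 + hw2)
  have e3 : ‖q‖ ^ 2 = β ^ 2 := by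
    simp [q, EuclideanSpace.real_norm_sq_eq, Fin.sum_univ_three]
    linear_combination β ^ 2 * (hu2 + hv2 + hw2)
  have e4 : ‖q'‖ ^ 2 = β ^ 2 := by
    simp [q', EuclideanSpace.real_norm_sq_eq, Fin.sum_univ_three]
    linear_combination β ^ 2 * (hu2 + hv2 + hw2)
  have i1 : inner ℝ p q = α * β * r := by
    simp [p, q, PiLp.inner_apply, Fin.sum_univ_three]
    linear_combination α * β * (hu2 - hv2 + hw2)
  have i2 : inner ℝ p' q' = α * β * r := by
    simp [p', q', PiLp.inner_apply, Fin.sum_univ_three]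
    linear_combination α * β * (hu2 - hv2 + hw2)
  have i3 : inner ℝ p q' = α * β * r' := by
    simp [p, q', PiLp.inner_apply, Fin.sum_univ_three]
    linear_combination α * β * (hu2 - hv2 - hw2)
  have i4 : inner ℝ p' q = α * β * r' := by
    simp [p', q, PiLp.inner_apply, Fin.sum_univ_three]
    linear_combination α * β * (hu2 - hv2 - hw2)
  have n1 : ‖p - p'‖ = 2 * α * w := by
    refine (sq_eq_sq₀ (norm_nonneg _) (by positivity)).1 ?_
    simp [p, p', EuclideanSpace.real_norm_sq_eq, Fin.sum_univ_three]
    ring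
  have n2 : ‖q - q'‖ = 2 * β * w := by
    refine (sq_eq_sq₀ (norm_nonneg _) (by positivity)).1 ?_
    simp [q, q', EuclideanSpace.real_norm_sq_eq, Fin.sum_univ_three]
    ring
  have f1 : ‖p‖ ≤ R := ((sq_eq_sq₀ (norm_nonneg _) hα).1 e1).le.trans hαR
  have f2 : ‖p'‖ ≤ R := ((sq_eq_sq₀ (norm_nonneg _) hα).1 e2).le.trans hαR
  have f3 : ‖q‖ ≤ R := ((sq_eq_sq₀ (norm_nonneg _) hβ).1 e3).le.trans hβR
  have f4 : ‖q'‖ ≤ R := ((sq_eq_sq₀ (norm_nonneg _) hβ).1 e4).le.trans hβR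
  have hint := fun x y => integrable_comp_inner_mul hφ hM hlin
    (E := EuclideanSpace ℝ (Fin 3)) x y
  have key : 2 * (V φ !![α ^ 2, α * β * r; α * β * r, β ^ 2]
      - V φ !![α ^ 2, α * β * r'; α * β * r', β ^ 2]) =
      ∫ z, (φ (inner ℝ p z) - φ (inner ℝ p' z)) * (φ (inner ℝ q z) - φ (inner ℝ q' z))
        ∂(stdGaussian (EuclideanSpace ℝ (Fin 3))) := by
    have : ∀ z, (φ (inner ℝ p z) - φ (inner ℝ p' z)) * (φ (inner ℝ q z) - φ (inner ℝ q' z)) =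
        (φ (inner ℝ p z) * φ (inner ℝ q z) + φ (inner ℝ p' z) * φ (inner ℝ q' z))
        - (φ (inner ℝ p z) * φ (inner ℝ q' z) + φ (inner ℝ p' z) * φ (inner ℝ q z)) := by
      intro z; ring
    simp_rw [this]
    rw [integral_sub ((hint p q).fun_add (hint p' q')) ((hint p q').fun_add (hint p' q)),
      integral_add (hint p q) (hint p' q'), integral_add (hint p q') (hint p' q),
      ← V_eq_integral hφ p q e1 e3 i1, ← V_eq_integral hφ p' q' e2 e4 i2,
      ← V_eq_integral hφ p q' e1 e4 i3,
      ← V_eq_integral hφ p' q e2 e3 i4]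
    ring
  have bd : |∫ z, (φ (inner ℝ p z) - φ (inner ℝ p' z)) * (φ (inner ℝ q z) - φ (inner ℝ q' z))
        ∂(stdGaussian (EuclideanSpace ℝ (Fin 3)))| ≤ 2 * R ^ 2 * C ^ 2 * (r - r') * J := by
    rw [hJ, ← integral_const_mul, ← Real.norm_eq_abs]
    refine norm_integral_le_of_norm_le ((integrable_exp_mul_norm _).const_mul _)
      (Eventually.of_forall fun z => ?_)
    rw [Real.norm_eq_abs, abs_mul]
    calc _ ≤ (C * ‖p - p'‖ * Real.exp ((c * R + 1) * ‖z‖)) *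
          (C * ‖q - q'‖ * Real.exp ((c * R + 1) * ‖z‖)) := by
          gcongr
          · exact abs_comp_inner_sub_le hC hloc R p p' z f1 f2
          · exact abs_comp_inner_sub_le hC hloc R q q' z f3 f4
      _ = 2 * (α * β) * C ^ 2 * (r - r') * Real.exp (2 * (c * R + 1) * ‖z‖) := by
          rw [n1, n2, show 2 * (c * R + 1) * ‖z‖ = (c * R + 1) * ‖z‖ + (c * R + 1) * ‖z‖ by ring,
            Real.exp_add]
          linear_combination (4 * α * β * C ^ 2 * Real.exp ((c * R + 1) * ‖z‖) ^ 2) * hw2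
      _ ≤ _ := by
          have : α * β ≤ R ^ 2 := by nlinarith
          have h0 : 0 ≤ r - r' := by linarith
          gcongr
  rw [← key, abs_mul, abs_two] at bd
  rw [abs_of_nonneg (sub_nonneg.2 hle)]
  linarith

/-- Lipschitz dependence of `V φ` on the standard deviations `α, β` for a fixed correlation `r`:
only the lengths of the two vectors that realise the covariance matrix change. -/
lemma exists_abs_V_sub_le_scale (hφ : Continuous φ) (hM : 0 ≤ M)
    (hlin : ∀ u, |φ u| ≤ M * (1 + |u|)) (hC : 0 ≤ C)
    (hloc : ∀ R u v, |u| ≤ R → |v| ≤ R → |φ u - φ v| ≤ C * Real.exp (c * R) * |u - v|) (R : ℝ) :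
    ∃ L, 0 ≤ L ∧ ∀ α β α' β' r, |α| ≤ R → |β| ≤ R → |α'| ≤ R → |β'| ≤ R → |r| ≤ 1 →
      |V φ !![α ^ 2, α * β * r; α * β * r, β ^ 2]
          - V φ !![α' ^ 2, α' * β' * r; α' * β' * r, β' ^ 2]|
        ≤ L * (|α - α'| + |β - β'|) := by
  set J := ∫ z, Real.exp (((c * R + 1) + R) * ‖z‖) ∂(stdGaussian (EuclideanSpace ℝ (Fin 2)))
    with hJ
  have hJ0 : 0 ≤ J := integral_nonneg fun z => (Real.exp_pos _).le
  refine ⟨C * M * J, by positivity, ?_⟩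
  intro α β α' β' r hα hβ hα' hβ' hr
  rw [abs_le] at hr
  obtain ⟨u, hu⟩ : ∃ u, u = √((1 + r) / 2) := ⟨_, rfl⟩
  obtain ⟨v, hv⟩ : ∃ u, u = √((1 - r) / 2) := ⟨_, rfl⟩
  have hu2 : u * u = (1 + r) / 2 := by rw [hu]; exact Real.mul_self_sqrt (by linarith)
  have hv2 : v * v = (1 - r) / 2 := by rw [hv]; exact Real.mul_self_sqrt (by linarith)
  -- `e` and `f` are unit vectors with inner product `r`.
  let e : EuclideanSpace ℝ (Fin 2) := !₂[u, v]
  let f : EuclideanSpace ℝ (Fin 2) := !₂[u, -v]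
  have he : ‖e‖ = 1 := by
    refine (sq_eq_sq₀ (norm_nonneg _) zero_le_one).1 ?_
    simp [e, EuclideanSpace.real_norm_sq_eq, Fin.sum_univ_two]
    linear_combination hu2 + hv2
  have hf : ‖f‖ = 1 := by
    refine (sq_eq_sq₀ (norm_nonneg _) zero_le_one).1 ?_
    simp [f, EuclideanSpace.real_norm_sq_eq, Fin.sum_univ_two]
    linear_combination hu2 + hv2
  have hef : inner ℝ e f = r := by
    simp [e, f, PiLp.inner_apply, Fin.sum_univ_two]
    linear_combination hu2 - hv2
  have hV : ∀ α β : ℝ, V φ !![α ^ 2, α * β * r; α * β * r, β ^ 2] =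
      ∫ z, φ (inner ℝ (α • e) z) * φ (inner ℝ (β • f) z)
        ∂(stdGaussian (EuclideanSpace ℝ (Fin 2))) := by
    intro α β
    refine V_eq_integral hφ (α • e) (β • f) ?_ ?_ ?_
    · simp [norm_smul, he]
    · simp [norm_smul, hf]
    · simp [inner_smul_left, inner_smul_right, hef]; ring
  have hint := fun x y => integrable_comp_inner_mul hφ hM hlin
    (E := EuclideanSpace ℝ (Fin 2)) x y
  have n1 : ∀ α : ℝ, |α| ≤ R → ‖α • e‖ ≤ R := fun α h => by simpa [norm_smul, he] using h
  have n2 : ∀ α : ℝ, |α| ≤ R → ‖α • f‖ ≤ R := fun α h => by simpa [norm_smul, hf] using h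
  rw [hV, hV, ← integral_sub (hint _ _) (hint _ _), ← Real.norm_eq_abs,
    show C * M * J * (|α - α'| + |β - β'|) = C * M * (|α - α'| + |β - β'|) * J by ring, hJ,
    ← integral_const_mul]
  refine norm_integral_le_of_norm_le ((integrable_exp_mul_norm _).const_mul _)
    (Eventually.of_forall fun z => ?_)
  rw [Real.norm_eq_abs]
  have d1 := abs_comp_inner_sub_le hC hloc R (α • e) (α' • e) z (n1 _ hα) (n1 _ hα')
  have d2 := abs_comp_inner_sub_le hC hloc R (β • f) (β' • f) z (n2 _ hβ) (n2 _ hβ')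
  rw [← sub_smul, norm_smul, he, mul_one, Real.norm_eq_abs] at d1
  rw [← sub_smul, norm_smul, hf, mul_one, Real.norm_eq_abs] at d2
  have b1 := abs_comp_inner_le hM hlin R (α' • e) z (n1 _ hα')
  have b2 := abs_comp_inner_le hM hlin R (β • f) z (n2 _ hβ)
  calc _ = |(φ (inner ℝ (α • e) z) - φ (inner ℝ (α' • e) z)) * φ (inner ℝ (β • f) z)
        + φ (inner ℝ (α' • e) z) * (φ (inner ℝ (β • f) z) - φ (inner ℝ (β' • f) z))| := by
        congr 1; ring
    _ ≤ (C * |α - α'| * Real.exp ((c * R + 1) * ‖z‖)) * (M * Real.exp (R * ‖z‖))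
        + (M * Real.exp (R * ‖z‖)) * (C * |β - β'| * Real.exp ((c * R + 1) * ‖z‖)) := by
        refine (abs_add_le _ _).trans ?_
        rw [abs_mul, abs_mul]
        gcongr
    _ = _ := by
        rw [add_mul (c * R + 1) R, Real.exp_add]
        ring

lemma Admissible.exists_correlation {σ a b c : ℝ} (hσ : 0 < σ) (h : Admissible σ a b c) :
    ∃ r, |r| ≤ 1 ∧ √a * √b * r = c := by
  have ha : 0 < a := (pow_pos hσ 2).trans_le h.left
  have hb : 0 < b := (pow_pos hσ 2).trans_le h.right
  have hab : 0 < √a * √b := mul_pos (Real.sqrt_pos.2 ha) (Real.sqrt_pos.2 hb)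
  refine ⟨c / (√a * √b), ?_, mul_div_cancel₀ _ hab.ne'⟩
  rw [abs_div, abs_of_pos hab, div_le_one hab, ← Real.sqrt_mul ha.le]
  exact Real.abs_le_sqrt h.sq_le

/-- `V φ` is Lipschitz on bounded sets of covariance matrices with variances bounded away
from zero. -/
theorem exists_abs_V_sub_le (hlin : LinearlyBounded φ) (hac : ACWithExpBoundedDeriv φ) {σ : ℝ}
    (hσ : 0 < σ) (R : ℝ) :
    ∃ L, 0 ≤ L ∧ ∀ a b c a' b' c', Admissible σ a b c → Admissible σ a' b' c' →
      a ≤ R → b ≤ R → a' ≤ R → b' ≤ R →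
      |V φ !![a, c; c, b] - V φ !![a', c'; c', b']| ≤ L * (|a - a'| + |b - b'| + |c - c'|) := by
  obtain ⟨M, hM, hlin⟩ := hlin
  obtain ⟨C, c, hC, -, hloc⟩ := hac.exists_abs_sub_le
  obtain ⟨L₁, hL₁, h₁⟩ := exists_abs_V_sub_le_correlation hac.continuous hM.le hlin hC hloc √R
  obtain ⟨L₂, hL₂, h₂⟩ := exists_abs_V_sub_le_scale hac.continuous hM.le hlin hC hloc √R
  refine ⟨L₁ / σ ^ 2 * (√R / σ + 1) + L₂ / σ, by positivity, ?_⟩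
  intro a b c a' b' c' h h' haR hbR haR' hbR'
  obtain ⟨r, hr, hrc⟩ := h.exists_correlation hσ
  obtain ⟨r', hr', hrc'⟩ := h'.exists_correlation hσ
  have hpos : ∀ {x}, σ ^ 2 ≤ x → 0 ≤ x := fun hx => (sq_nonneg σ).trans hx
  have hsq : ∀ {x}, σ ^ 2 ≤ x → σ ≤ √x := fun hx => Real.le_sqrt_of_sq_le hx
  have hsR : ∀ {x}, x ≤ R → √x ≤ √R := fun hx => Real.sqrt_le_sqrt hx
  have hd : ∀ {x y}, σ ^ 2 ≤ x → σ ^ 2 ≤ y → |√x - √y| ≤ |x - y| / σ := by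
    intro x y hx hy
    rw [le_div_iff₀ hσ]
    have e : x - y = (√x - √y) * (√x + √y) := by
      have := Real.mul_self_sqrt (hpos hx)
      have := Real.mul_self_sqrt (hpos hy)
      linarith
    rw [e, abs_mul]
    gcongr
    rw [abs_of_nonneg (by positivity)]
    linarith [hsq hx, Real.sqrt_nonneg y]
  set α := √a
  set β := √b
  set α' := √a'
  set β' := √b'
  have hda := hd h.left h'.left
  have hdb := hd h.right h'.right
  have hσα : σ ≤ α := hsq h.left
  have hσβ : σ ≤ β := hsq h.right
  have k₁ := h₁ α β r r' (Real.sqrt_nonneg _) (hsR haR) (Real.sqrt_nonneg _) (hsR hbR) hr hr'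
  have habs : ∀ {x}, x ≤ R → |√x| ≤ √R := fun hx => by
    rw [abs_of_nonneg (Real.sqrt_nonneg _)]; exact hsR hx
  have k₂ := h₂ α β α' β' r' (habs haR) (habs hbR) (habs haR') (habs hbR') hr'
  rw [hrc'] at k₂
  rw [hrc] at k₁
  rw [Real.sq_sqrt (hpos h.left), Real.sq_sqrt (hpos h.right)] at k₁ k₂
  rw [Real.sq_sqrt (hpos h'.left), Real.sq_sqrt (hpos h'.right)] at k₂
  -- The correlation is Lipschitz in the entries as the variances are bounded away from zero.
  have hρ : |r - r'| ≤ (|c - c'| + √R * (|a - a'| / σ + |b - b'| / σ)) / σ ^ 2 := by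
    rw [le_div_iff₀ (by positivity)]
    have e : (r - r') * (α * β) = (c - c') + r' * ((α' - α) * β' + α * (β' - β)) := by
      rw [← hrc, ← hrc']; ring
    calc |r - r'| * σ ^ 2 ≤ |r - r'| * (α * β) := by gcongr; nlinarith
      _ = |(r - r') * (α * β)| := by
          rw [abs_mul (r - r'), abs_of_nonneg (a := α * β) (by positivity)]
      _ ≤ |c - c'| + 1 * (|α - α'| * √R + √R * |β - β'|) := by
          rw [e]
          refine (abs_add_le _ _).trans ?_
          rw [abs_mul r']
          gcongr
          refine (abs_add_le _ _).trans ?_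
          rw [abs_mul, abs_mul, abs_sub_comm α', abs_sub_comm β']
          gcongr
          · exact habs hbR'
          · exact habs haR
      _ ≤ |c - c'| + 1 * (|a - a'| / σ * √R + √R * (|b - b'| / σ)) := by gcongr
      _ = _ := by ring
  calc |V φ !![a, c; c, b] - V φ !![a', c'; c', b']| ≤
        |V φ !![a, c; c, b] - V φ !![a, α * β * r'; α * β * r', b]|
        + |V φ !![a, α * β * r'; α * β * r', b] - V φ !![a', c'; c', b']| := abs_sub_le _ _ _
    _ ≤ L₁ * ((|c - c'| + √R * (|a - a'| / σ + |b - b'| / σ)) / σ ^ 2)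
        + L₂ * (|a - a'| / σ + |b - b'| / σ) := by
        gcongr
        · exact k₁.trans (by gcongr)
        · exact k₂.trans (by gcongr)
    _ ≤ _ := by
        have e : (L₁ / σ ^ 2 * (√R / σ + 1) + L₂ / σ) * (|a - a'| + |b - b'| + |c - c'|)
          - (L₁ * ((|c - c'| + √R * (|a - a'| / σ + |b - b'| / σ)) / σ ^ 2)
          + L₂ * (|a - a'| / σ + |b - b'| / σ)) =
          L₁ / σ ^ 2 * (|a - a'| + |b - b'|) + L₁ / σ ^ 2 * (√R / σ) * |c - c'|
            + L₂ / σ * |c - c'| := by ring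
        have : 0 ≤ L₁ / σ ^ 2 * (|a - a'| + |b - b'|) + L₁ / σ ^ 2 * (√R / σ) * |c - c'|
            + L₂ / σ * |c - c'| := by positivity
        linarith

/-- `V φ` grows at most linearly in the variances. -/
theorem exists_abs_V_le (hφ : Continuous φ) (hlin : LinearlyBounded φ) :
    ∃ A, 0 ≤ A ∧ ∀ σ a b c, Admissible σ a b c → |V φ !![a, c; c, b]| ≤ A * (2 + a + b) := by
  obtain ⟨M, hM, hlin⟩ := hlin
  set J := ∫ z, Real.exp (2 * ‖z‖) ∂(stdGaussian (EuclideanSpace ℝ (Fin 2))) with hJ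
  have hJ0 : 0 ≤ J := integral_nonneg fun z => (Real.exp_pos _).le
  refine ⟨M ^ 2 * J, by positivity, fun σ a b c h => ?_⟩
  obtain ⟨p, hp⟩ := exists_factor_of_posSemidef h.posSemidef
  have h0 := hp 0 0
  have h1 := hp 1 1
  have h01 := hp 0 1
  simp only [real_inner_self_eq_norm_sq, Matrix.of_apply, Matrix.cons_val', Matrix.cons_val_zero,
    Matrix.cons_val_one, Matrix.cons_val_fin_one] at h0 h1 h01
  rw [V_eq_integral hφ (p 0) (p 1) h0 h1 h01, mul_right_comm, hJ, ← integral_const_mul,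
    ← Real.norm_eq_abs]
  refine norm_integral_le_of_norm_le ((integrable_exp_mul_norm _).const_mul _)
    (Eventually.of_forall fun z => ?_)
  rw [Real.norm_eq_abs, abs_mul]
  have hz : ‖z‖ ^ 2 ≤ Real.exp (2 * ‖z‖) := by
    rw [two_mul, Real.exp_add, sq]
    have := Real.add_one_le_exp ‖z‖
    gcongr <;> linarith
  have hz1 : 1 ≤ Real.exp (2 * ‖z‖) := Real.one_le_exp (by positivity)
  have hi : ∀ i, |φ (inner ℝ (p i) z)| ≤ M * (1 + ‖p i‖ * ‖z‖) := fun i =>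
    (hlin _).trans (by gcongr; exact abs_real_inner_le_norm _ _)
  calc _ ≤ (M * (1 + ‖p 0‖ * ‖z‖)) * (M * (1 + ‖p 1‖ * ‖z‖)) := by gcongr <;> exact hi _
    _ ≤ M ^ 2 * (2 + (‖p 0‖ ^ 2 + ‖p 1‖ ^ 2) * ‖z‖ ^ 2) := by
        have : (1 + ‖p 0‖ * ‖z‖) * (1 + ‖p 1‖ * ‖z‖) ≤ 2 + (‖p 0‖ ^ 2 + ‖p 1‖ ^ 2) * ‖z‖ ^ 2 := by
          nlinarith [sq_nonneg (‖p 0‖ * ‖z‖ - ‖p 1‖ * ‖z‖), sq_nonneg (‖p 0‖ * ‖z‖ - 1),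
            sq_nonneg (‖p 1‖ * ‖z‖ - 1)]
        nlinarith [mul_le_mul_of_nonneg_left this (sq_nonneg M)]
    _ ≤ M ^ 2 * (2 * Real.exp (2 * ‖z‖) + (‖p 0‖ ^ 2 + ‖p 1‖ ^ 2) * Real.exp (2 * ‖z‖)) := by
        gcongr; linarith
    _ = _ := by rw [h0, h1]; ring

end Lipschitz

/-! ### Positivity of the discrete kernel -/

section Discrete

lemma posSemidef_integral_mul {κ Ω : Type*} [Fintype κ] [MeasurableSpace Ω] {μ : Measure Ω}
    (f : κ → Ω → ℝ) (hf : ∀ i j, Integrable (fun z => f i z * f j z) μ) :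
    (Matrix.of fun i j => ∫ z, f i z * f j z ∂μ).PosSemidef := by
  rw [Matrix.posSemidef_iff_dotProduct_mulVec]
  refine ⟨by ext i j; simp [mul_comm], fun v => ?_⟩
  have h : star v ⬝ᵥ (Matrix.of fun i j => ∫ z, f i z * f j z ∂μ).mulVec v =
      ∫ z, (∑ i, v i * f i z) ^ 2 ∂μ := by
    have : ∀ z, (∑ i, v i * f i z) ^ 2 = ∑ i, ∑ j, (v i * v j) * (f i z * f j z) := by
      intro z
      rw [sq, Finset.sum_mul_sum]
      refine Finset.sum_congr rfl fun i _ => Finset.sum_congr rfl fun j _ => by ring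
    simp_rw [this]
    rw [integral_finsetSum _ fun i _ => integrable_finsetSum _ fun j _ => (hf i j).const_mul _]
    simp_rw [integral_finsetSum _ fun j _ => (hf _ j).const_mul _, integral_const_mul]
    simp only [dotProduct, Matrix.mulVec, Pi.star_apply, star_trivial, Matrix.of_apply,
      Finset.mul_sum]
    refine Finset.sum_congr rfl fun i _ => Finset.sum_congr rfl fun j _ => by ring
  rw [h]
  exact integral_nonneg fun z => sq_nonneg _

variable (φ : ℝ → ℝ) (σa σA σb : ℝ) {d : ℕ} (D : UnitPartition)

/-- The coefficient `σ_A² V_φ(Σ(t_m, t_n)) + σ_b²` in the recursion for the discrete kernel. -/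
noncomputable def discreteCoeff (x y : SobolevPath d) (m n : ℕ) : ℝ :=
  σA ^ 2 * V φ !![discreteKernel φ σa σA σb D x x m m, discreteKernel φ σa σA σb D x y m n;
    discreteKernel φ σa σA σb D x y m n, discreteKernel φ σa σA σb D y y n n] + σb ^ 2

/-- The increment of a path over the `m`-th interval of a partition. -/
def increment (x : SobolevPath d) (m : ℕ) : EuclideanSpace ℝ (Fin d) :=
  x.toFun (D.pt (m + 1)) - x.toFun (D.pt m)

lemma discreteKernel_succ_succ (x y : SobolevPath d) (m n : ℕ) :
    discreteKernel φ σa σA σb D x y (m + 1) (n + 1) =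
      discreteKernel φ σa σA σb D x y m (n + 1) + discreteKernel φ σa σA σb D x y (m + 1) n
        - discreteKernel φ σa σA σb D x y m n + discreteCoeff φ σa σA σb D x y m n *
          inner ℝ (increment D x m) (increment D y n) := by
  rw [discreteKernel]
  rfl

lemma discreteKernel_eq_sum (x y : SobolevPath d) (m n : ℕ) :
    discreteKernel φ σa σA σb D x y m n = σa ^ 2 + ∑ i ∈ Finset.range m, ∑ j ∈ Finset.range n,
      discreteCoeff φ σa σA σb D x y i j * inner ℝ (increment D x i) (increment D y j) := by
  induction m generalizing n with
  | zero => simp [discreteKernel]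
  | succ m ihm =>
    induction n with
    | zero => simp [discreteKernel]
    | succ n ihn =>
      rw [discreteKernel_succ_succ, ihm (n + 1), ihn, ihm n]
      simp only [Finset.sum_range_succ, Finset.sum_add_distrib]
      ring

/-- If the values of the discrete kernel form a covariance matrix, then so do the coefficients: up
to `σ_b²`, they are second moments of the images under `φ` of a Gaussian vector with this
covariance. -/
lemma posSemidef_discreteCoeff {φ : ℝ → ℝ} (hφ : Continuous φ) (hlin : LinearlyBounded φ)
    {κ : Type*} [Fintype κ] [DecidableEq κ] (X : κ → SobolevPath d) (m : κ → ℕ)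
    (h : (Matrix.of fun p q => discreteKernel φ σa σA σb D (X p) (X q) (m p) (m q)).PosSemidef) :
    (Matrix.of fun p q => discreteCoeff φ σa σA σb D (X p) (X q) (m p) (m q)).PosSemidef := by
  obtain ⟨M, hM, hlin⟩ := hlin
  obtain ⟨P, hP⟩ := exists_factor_of_posSemidef h
  have h1 := (posSemidef_integral_mul (μ := stdGaussian (EuclideanSpace ℝ κ))
    (fun p z => φ (inner ℝ (P p) z))
    fun i j => integrable_comp_inner_mul hφ hM.le hlin (P i) (P j)).smul (sq_nonneg σA)
  have h2 := Matrix.posSemidef_gram ℝ fun _ : κ => σb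
  have h3 := h1.add h2
  convert h3 using 1
  ext p q
  simp only [Matrix.of_apply, Matrix.add_apply, Matrix.smul_apply, Matrix.gram, discreteCoeff,
    smul_eq_mul]
  congr 1
  · rw [V_eq_integral hφ (P p) (P q)]
    · rw [← real_inner_self_eq_norm_sq, hP]; rfl
    · rw [← real_inner_self_eq_norm_sq, hP]; rfl
    · rw [hP]; rfl
  · simp [sq]

/-- The discrete kernel minus `σ_a²` is a positive semidefinite kernel on pairs of a path and a
time: if this holds up to time `M`, the kernel is the covariance of a Gaussian family, so its
coefficients form a positive semidefinite kernel as well, and one more step of the recursion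
multiplies these by a Gram matrix of increments and sums up. -/
lemma posSemidef_discreteKernel_sub {φ : ℝ → ℝ} (hφ : Continuous φ) (hlin : LinearlyBounded φ)
    {β : Type*} [Fintype β] [DecidableEq β] (X : β → SobolevPath d) (M : ℕ) :
    (Matrix.of fun p q : β × Fin M =>
      discreteKernel φ σa σA σb D (X p.1) (X q.1) p.2 q.2 - σa ^ 2).PosSemidef := by
  induction M with
  | zero =>
    convert Matrix.PosSemidef.zero (R := ℝ) (n := β × Fin 0)
    ext p
    exact p.2.elim0
  | succ M ih =>
    have h1 := ih.add (Matrix.posSemidef_gram ℝ fun _ : β × Fin M => σa)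
    have h2 : (Matrix.of fun p q : β × Fin M =>
        discreteKernel φ σa σA σb D (X p.1) (X q.1) p.2 q.2).PosSemidef := by
      convert h1 using 1
      ext p q
      simp [Matrix.gram, sq]
    have h3 := (posSemidef_discreteCoeff σa σA σb D hφ hlin (fun p : β × Fin M => X p.1)
      (fun p => p.2) h2).hadamard
      (Matrix.posSemidef_gram ℝ fun p : β × Fin M => increment D (X p.1) p.2)
    -- Multiplication by `B` sums over the earlier time steps of the same path.
    let B : Matrix (β × Fin (M + 1)) (β × Fin M) ℝ :=
      Matrix.of fun p q => if p.1 = q.1 ∧ (q.2 : ℕ) < p.2 then 1 else 0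
    have h4 := h3.mul_mul_conjTranspose_same B
    have hB : ∀ (p : β × Fin (M + 1)) (f : β × Fin M → ℝ),
        ∑ q, B p q * f q = ∑ i : Fin M, if (i : ℕ) < p.2 then f (p.1, i) else 0 := by
      intro p f
      rw [Fintype.sum_prod_type, Finset.sum_comm]
      refine Finset.sum_congr rfl fun i _ => ?_
      rw [Finset.sum_eq_single p.1]
      · simp [B]
      · intro b _ hb
        simp [B, hb.symm]
      · simp
    have hR : ∀ (k : Fin (M + 1)) (f : ℕ → ℝ),
        ∑ i : Fin M, (if (i : ℕ) < k then f i else 0) = ∑ i ∈ Finset.range k, f i := by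
      intro k f
      rw [Fin.sum_univ_eq_sum_range (fun i => if i < (k : ℕ) then f i else 0) M,
        ← Finset.sum_filter]
      congr 1
      ext i
      have := k.2
      simp only [Finset.mem_filter, Finset.mem_range]
      omega
    refine (congrArg Matrix.PosSemidef ?_).mpr h4
    ext p q
    simp only [Matrix.mul_apply, Matrix.conjTranspose_apply, star_trivial, Matrix.of_apply]
    rw [discreteKernel_eq_sum, add_sub_cancel_left]
    have h5 := fun (A : Matrix (β × Fin M) (β × Fin M) ℝ) (j : β × Fin M) =>
      (congrArg (· * B q j) (hB p fun k => A k j)).trans (mul_comm _ _)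
    refine .trans ?_ (Finset.sum_congr rfl fun j _ => (h5 _ j).symm)
    rw [hB q]
    simp only [Matrix.hadamard_apply, Matrix.gram, Matrix.of_apply]
    rw [hR q.2 (fun j => ∑ i : Fin M, if (i : ℕ) < p.2 then
      discreteCoeff φ σa σA σb D (X p.1) (X q.1) i j *
        inner ℝ (increment D (X p.1) i) (increment D (X q.1) j) else 0), Finset.sum_comm]
    refine Finset.sum_congr rfl fun j _ => ?_
    rw [hR p.2 (fun i => discreteCoeff φ σa σA σb D (X p.1) (X q.1) i j *
        inner ℝ (increment D (X p.1) i) (increment D (X q.1) j))]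

/-- The positive semidefinite kernel, restricted to the two points `(x, m)` and `(y, n)`. -/
theorem admissible_discreteKernel {φ : ℝ → ℝ} (hφ : Continuous φ) (hlin : LinearlyBounded φ)
    (x y : SobolevPath d) (m n : ℕ) :
    Admissible σa (discreteKernel φ σa σA σb D x x m m) (discreteKernel φ σa σA σb D y y n n)
      (discreteKernel φ σa σA σb D x y m n) := by
  have h := (posSemidef_discreteKernel_sub σa σA σb D hφ hlin ![x, y] (max m n + 1)).submatrix
    ![((0 : Fin 2), (⟨m, by omega⟩ : Fin (max m n + 1))), (1, ⟨n, by omega⟩)]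
  have h0 := h.diag_nonneg (i := 0)
  have h1 := h.diag_nonneg (i := 1)
  have h' := (h.add (Matrix.posSemidef_gram ℝ fun _ : Fin 2 => σa))
  have h2 := h'.det_nonneg
  have h3 := h.isHermitian.apply 0 1
  rw [Matrix.det_fin_two] at h2
  simp only [Matrix.add_apply, Matrix.submatrix_apply, Matrix.of_apply, Matrix.gram,
    Matrix.cons_val_zero, Matrix.cons_val_one, Matrix.cons_val_fin_one, star_trivial,
    real_inner_self_eq_norm_sq, Real.norm_eq_abs, sq_abs, sub_add_cancel, sub_nonneg,
    sub_left_inj] at h0 h1 h2 h3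
  refine ⟨h0, h1, ?_⟩
  rw [h3] at h2
  nlinarith

end Discrete

/-! ### Paths and double integrals against their velocities -/

section Velocity
variable {d : ℕ} (x y : SobolevPath d)

lemma SobolevPath.apply_eq_integral (t : unitInterval) :
    x.toFun t = ∫ r in (0 : ℝ)..(t : ℝ), x.velocity r :=
  x.exists_velocity.choose_spec t

lemma SobolevPath.norm_nonneg : 0 ≤ ‖x‖ := _root_.norm_nonneg x.velocity

lemma integrable_velocity : Integrable x.velocity unitVol :=
  (Lp.memLp x.velocity).integrable (by norm_num)

lemma Ioc_subset_Icc_unit {a b : ℝ} (ha : a ∈ Icc (0 : ℝ) 1) (hb : b ∈ Icc (0 : ℝ) 1) :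
    Ioc a b ⊆ Icc 0 1 :=
  Ioc_subset_Icc_self.trans (Icc_subset_Icc ha.1 hb.2)

lemma intervalIntegrable_of_unitVol {F : Type*} [NormedAddCommGroup F] {f : ℝ → F}
    (hf : Integrable f unitVol) {a b : ℝ} (ha : a ∈ Icc (0 : ℝ) 1) (hb : b ∈ Icc (0 : ℝ) 1) :
    IntervalIntegrable f volume a b :=
  ⟨hf.mono_measure (Measure.restrict_mono (Ioc_subset_Icc_unit ha hb) le_rfl),
    hf.mono_measure (Measure.restrict_mono (Ioc_subset_Icc_unit hb ha) le_rfl)⟩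

lemma intervalIntegrable_velocity {a b : ℝ} (ha : a ∈ Icc (0 : ℝ) 1) (hb : b ∈ Icc (0 : ℝ) 1) :
    IntervalIntegrable x.velocity volume a b :=
  intervalIntegrable_of_unitVol (integrable_velocity x) ha hb

lemma intervalIntegrable_mul_norm_velocity {g : ℝ → ℝ} (hg : Continuous g) {a b : ℝ}
    (ha : a ∈ Icc (0 : ℝ) 1) (hb : b ∈ Icc (0 : ℝ) 1) :
    IntervalIntegrable (fun η => g η * ‖x.velocity η‖) volume a b :=
  (intervalIntegrable_velocity x ha hb).norm.continuousOn_mul hg.continuousOn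

lemma increment_eq_integral (D : UnitPartition) (i : ℕ) :
    increment D x i = ∫ r in (D.pt i : ℝ)..(D.pt (i + 1) : ℝ), x.velocity r := by
  have h0 : (0 : ℝ) ∈ Icc (0 : ℝ) 1 := by simp
  rw [increment, x.apply_eq_integral, x.apply_eq_integral,
    intervalIntegral.integral_interval_sub_left]
  · exact intervalIntegrable_velocity x h0 (D.pt (i + 1)).2
  · exact intervalIntegrable_velocity x h0 (D.pt i).2

/-- The Cauchy-Schwarz inequality for a weight and the speed of a path. -/
lemma integral_mul_norm_velocity_le {g : ℝ → ℝ} (hg : Continuous g) (hg0 : ∀ r, 0 ≤ g r) {a b : ℝ}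
    (ha : a ∈ Icc (0 : ℝ) 1) (hb : b ∈ Icc (0 : ℝ) 1) (hab : a ≤ b) :
    ∫ η in a..b, g η * ‖x.velocity η‖ ≤ √(∫ η in a..b, g η ^ 2) * ‖x‖ := by
  have hle : volume.restrict (Ioc a b) ≤ unitVol :=
    Measure.restrict_mono (Ioc_subset_Icc_unit ha hb) le_rfl
  have hx : MemLp x.velocity 2 (volume.restrict (Ioc a b)) := (Lp.memLp x.velocity).mono_measure hle
  have hgm : MemLp g 2 (volume.restrict (Ioc a b)) := by
    rw [memLp_two_iff_integrable_sq hg.aestronglyMeasurable]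
    exact ((hg.pow 2).integrableOn_Icc (a := a) (b := b)).mono_set Ioc_subset_Icc_self
  rw [intervalIntegral.integral_of_le hab, intervalIntegral.integral_of_le hab]
  have h := integral_mul_norm_le_Lp_mul_Lq (μ := volume.restrict (Ioc a b)) (f := g)
    (g := fun η => ‖x.velocity η‖) Real.HolderConjugate.two_two
    (by simpa using hgm) (by simpa using hx.norm)
  simp only [norm_norm, Real.norm_of_nonneg (hg0 _), Real.rpow_two, ← Real.sqrt_eq_rpow] at h
  refine h.trans (mul_le_mul_of_nonneg_left ?_ (Real.sqrt_nonneg _))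
  have hn : ‖x‖ = √(∫ r, ‖x.velocity r‖ ^ 2 ∂unitVol) := by
    change ‖x.velocity‖ = _
    rw [norm_eq_sqrt_real_inner, L2.inner_def]
    simp_rw [real_inner_self_eq_norm_sq]
  rw [hn]
  refine Real.sqrt_le_sqrt (integral_mono_measure hle ?_ ?_)
  · exact Eventually.of_forall fun _ => by positivity
  · exact (Lp.memLp x.velocity).integrable_norm_pow (by norm_num)

lemma integral_norm_velocity_le {a b : ℝ}
    (ha : a ∈ Icc (0 : ℝ) 1) (hb : b ∈ Icc (0 : ℝ) 1) (hab : a ≤ b) :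
    ∫ η in a..b, ‖x.velocity η‖ ≤ ‖x‖ * √(b - a) := by
  have := integral_mul_norm_velocity_le x (g := fun _ => 1) continuous_const
    (fun _ => zero_le_one) ha hb hab
  simpa [mul_comm] using this

lemma integral_exp_mul_norm_velocity_le {l : ℝ} (hl : 0 < l) {s : ℝ} (hs : s ∈ Icc (0 : ℝ) 1) :
    ∫ η in (0 : ℝ)..s, Real.exp (l * η) * ‖x.velocity η‖ ≤ ‖x‖ * (Real.exp (l * s) / √(2 * l)) := by
  have h := integral_mul_norm_velocity_le x (g := fun η => Real.exp (l * η)) (by fun_prop)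
    (fun _ => (Real.exp_pos _).le) (a := 0) (by simp) hs hs.1
  rw [mul_comm ‖x‖]
  refine h.trans (mul_le_mul_of_nonneg_right ?_ (SobolevPath.norm_nonneg x))
  rw [Real.sqrt_le_left (by positivity), div_pow, Real.sq_sqrt (by positivity),
    le_div_iff₀ (by positivity)]
  have : ∀ η : ℝ, Real.exp (l * η) ^ 2 = Real.exp ((2 * l) * η) := fun η => by
    rw [← Real.exp_nat_mul]; congr 1; push_cast; ring
  simp_rw [this]
  rw [intervalIntegral.integral_comp_mul_left (fun u => Real.exp u) (by positivity), integral_exp]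
  simp
  field_simp
  linarith

end Velocity

section PairIntegral
variable {d : ℕ}

/-- The integral of `w(η, τ) ⟨x'(η), y'(τ)⟩` over `[0, s] × [0, t]`. -/
noncomputable def pairIntegral (w : ℝ → ℝ → ℝ) (x y : SobolevPath d) (s t : ℝ) : ℝ :=
  ∫ η in (0 : ℝ)..s, ∫ τ in (0 : ℝ)..t, w η τ * inner ℝ (x.velocity η) (y.velocity τ)

/-- The function `w` is almost everywhere measurable on the unit square and bounded by `c` there. Its
values elsewhere play no role. -/
structure BoundedMeasurable (w : ℝ → ℝ → ℝ) (c : ℝ) : Prop where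
  aestronglyMeasurable : AEStronglyMeasurable (fun p : ℝ × ℝ => w p.1 p.2) (unitVol.prod unitVol)
  abs_le : ∀ η ∈ Icc (0 : ℝ) 1, ∀ τ ∈ Icc (0 : ℝ) 1, |w η τ| ≤ c

variable {w w' : ℝ → ℝ → ℝ} {c c' : ℝ} (x y : SobolevPath d)

lemma BoundedMeasurable.nonneg (hw : BoundedMeasurable w c) : 0 ≤ c :=
  (abs_nonneg _).trans (hw.abs_le 0 (by simp) 0 (by simp))

lemma BoundedMeasurable.integrable (hw : BoundedMeasurable w c) :
    Integrable (fun p : ℝ × ℝ => w p.1 p.2 * inner ℝ (x.velocity p.1) (y.velocity p.2))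
      (unitVol.prod unitVol) := by
  have hx := integrable_velocity x
  have hy := integrable_velocity y
  refine ((hx.norm.mul_prod hy.norm).const_mul c).mono' (hw.aestronglyMeasurable.mul ?_) ?_
  · exact hx.aestronglyMeasurable.comp_fst.inner hy.aestronglyMeasurable.comp_snd
  · rw [Measure.prod_restrict]
    refine (ae_restrict_iff' (measurableSet_Icc.prod measurableSet_Icc)).2
      (Eventually.of_forall fun p hp => ?_)
    rw [Real.norm_eq_abs, abs_mul]
    have := hw.nonneg
    gcongr
    · exact hw.abs_le _ hp.1 _ hp.2
    · exact abs_real_inner_le_norm _ _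

lemma ae_Ioc_of_ae_unitVol {p : ℝ → Prop} {s : ℝ} (hs : s ∈ Icc (0 : ℝ) 1)
    (h : ∀ᵐ η ∂unitVol, p η) :
    ∀ᵐ η, η ∈ Ioc 0 s → p η := by
  rw [ae_restrict_iff' measurableSet_Icc] at h
  filter_upwards [h] with η hη hm using hη (Ioc_subset_Icc_unit (by simp) hs hm)

lemma BoundedMeasurable.ae_integrable (hw : BoundedMeasurable w c) :
    ∀ᵐ η ∂unitVol,
      Integrable (fun τ => w η τ * inner ℝ (x.velocity η) (y.velocity τ)) unitVol :=
  (hw.integrable x y).prod_right_ae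

lemma BoundedMeasurable.integrable_inner (hw : BoundedMeasurable w c) {t : ℝ}
    (ht : t ∈ Icc (0 : ℝ) 1) :
    Integrable (fun η => ∫ τ in (0 : ℝ)..t, w η τ * inner ℝ (x.velocity η) (y.velocity τ))
      unitVol := by
  have h : Integrable (fun p : ℝ × ℝ => w p.1 p.2 * inner ℝ (x.velocity p.1) (y.velocity p.2))
      (unitVol.prod (volume.restrict (Ioc 0 t))) := by
    refine (hw.integrable x y).mono_measure ?_
    rw [Measure.prod_restrict, Measure.prod_restrict]
    exact Measure.restrict_mono
      (prod_mono le_rfl (Ioc_subset_Icc_unit (a := 0) (by simp) ht)) le_rfl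
  simp_rw [intervalIntegral.integral_of_le ht.1]
  exact h.integral_prod_left

lemma pairIntegral_sub (hw : BoundedMeasurable w c) (hw' : BoundedMeasurable w' c') {s t : ℝ}
    (hs : s ∈ Icc (0 : ℝ) 1) (ht : t ∈ Icc (0 : ℝ) 1) :
    pairIntegral w x y s t - pairIntegral w' x y s t =
      pairIntegral (fun η τ => w η τ - w' η τ) x y s t := by
  have h0 : (0 : ℝ) ∈ Icc (0 : ℝ) 1 := by simp
  rw [pairIntegral, pairIntegral, pairIntegral, ← intervalIntegral.integral_sub
    (intervalIntegrable_of_unitVol (hw.integrable_inner x y ht) h0 hs)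
    (intervalIntegrable_of_unitVol (hw'.integrable_inner x y ht) h0 hs)]
  refine intervalIntegral.integral_congr_ae ?_
  rw [uIoc_of_le hs.1]
  filter_upwards [ae_Ioc_of_ae_unitVol hs (hw.ae_integrable x y),
    ae_Ioc_of_ae_unitVol hs (hw'.ae_integrable x y)] with η h1 h2 hη
  rw [← intervalIntegral.integral_sub (intervalIntegrable_of_unitVol (h1 hη) h0 ht)
    (intervalIntegrable_of_unitVol (h2 hη) h0 ht)]
  simp_rw [sub_mul]

/-- An integrand dominated by `ε + N (e^{lη} + e^{lτ})`: by the Cauchy-Schwarz inequality, the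
exponential weights gain a factor `1 / √(2l)`. -/
lemma abs_pairIntegral_le {ε N l : ℝ} (hε : 0 ≤ ε) (hN : 0 ≤ N) (hl : 0 < l)
    (h : ∀ η ∈ Icc (0 : ℝ) 1, ∀ τ ∈ Icc (0 : ℝ) 1,
      |w η τ| ≤ ε + N * (Real.exp (l * η) + Real.exp (l * τ))) {s t : ℝ}
    (hs : s ∈ Icc (0 : ℝ) 1) (ht : t ∈ Icc (0 : ℝ) 1) :
    |pairIntegral w x y s t| ≤
      ‖x‖ * ‖y‖ * (ε + N * ((Real.exp (l * s) + Real.exp (l * t)) / √(2 * l))) := by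
  have h0 : (0 : ℝ) ∈ Icc (0 : ℝ) 1 := by simp
  have nx := SobolevPath.norm_nonneg x
  have ny := SobolevPath.norm_nonneg y
  have hone : ∀ z : SobolevPath d, ∀ s ∈ Icc (0 : ℝ) 1,
      ∫ η in (0 : ℝ)..s, ‖z.velocity η‖ ≤ ‖z‖ := by
    intro z s hs
    refine (integral_norm_velocity_le z h0 hs hs.1).trans ?_
    refine mul_le_of_le_one_right (SobolevPath.norm_nonneg z)
      (Real.sqrt_le_one.2 (by linarith [hs.2]))
  have hin : ∀ η ∈ Icc (0 : ℝ) 1,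
      ‖∫ τ in (0 : ℝ)..t, w η τ * inner ℝ (x.velocity η) (y.velocity τ)‖ ≤
      (ε + N * (Real.exp (l * t) / √(2 * l))) * ‖y‖ * ‖x.velocity η‖
        + N * ‖y‖ * (Real.exp (l * η) * ‖x.velocity η‖) := by
    intro η hη
    refine (intervalIntegral.norm_integral_le_of_norm_le ht.1 (g := fun τ =>
      ((ε + N * Real.exp (l * η)) * ‖x.velocity η‖) * ‖y.velocity τ‖ + (N * ‖x.velocity η‖) *
        (Real.exp (l * τ) * ‖y.velocity τ‖)) (Eventually.of_forall fun τ hτ => ?_) ?_).trans ?_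
    · rw [Real.norm_eq_abs, abs_mul]
      have h1 := h η hη τ (Ioc_subset_Icc_unit h0 ht hτ)
      calc _ ≤ (ε + N * (Real.exp (l * η) + Real.exp (l * τ))) *
            (‖x.velocity η‖ * ‖y.velocity τ‖) := by
            gcongr
            exact abs_real_inner_le_norm _ _
        _ = _ := by ring
    · exact ((intervalIntegrable_velocity y h0 ht).norm.const_mul _).add
        ((intervalIntegrable_mul_norm_velocity y (by fun_prop) h0 ht).const_mul _)
    · rw [intervalIntegral.integral_add ((intervalIntegrable_velocity y h0 ht).norm.const_mul _)
        ((intervalIntegrable_mul_norm_velocity y (by fun_prop) h0 ht).const_mul _),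
        intervalIntegral.integral_const_mul, intervalIntegral.integral_const_mul]
      calc _ ≤ ((ε + N * Real.exp (l * η)) * ‖x.velocity η‖) * ‖y‖ + (N * ‖x.velocity η‖) *
            (‖y‖ * (Real.exp (l * t) / √(2 * l))) := by
            gcongr
            · exact hone y t ht
            · exact integral_exp_mul_norm_velocity_le y hl ht
        _ = _ := by ring
  rw [pairIntegral, ← Real.norm_eq_abs]
  refine (intervalIntegral.norm_integral_le_of_norm_le hs.1 (Eventually.of_forall fun η hη =>
    hin η (Ioc_subset_Icc_unit h0 hs hη)) ?_).trans ?_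
  · exact ((intervalIntegrable_velocity x h0 hs).norm.const_mul _).add
      ((intervalIntegrable_mul_norm_velocity x (by fun_prop) h0 hs).const_mul _)
  · rw [intervalIntegral.integral_add ((intervalIntegrable_velocity x h0 hs).norm.const_mul _)
      ((intervalIntegrable_mul_norm_velocity x (by fun_prop) h0 hs).const_mul _),
      intervalIntegral.integral_const_mul, intervalIntegral.integral_const_mul]
    calc _ ≤ (ε + N * (Real.exp (l * t) / √(2 * l))) * ‖y‖ * ‖x‖
          + N * ‖y‖ * (‖x‖ * (Real.exp (l * s) / √(2 * l))) := by
          gcongr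
          · exact hone x s hs
          · exact integral_exp_mul_norm_velocity_le x hl hs
      _ = _ := by ring

lemma abs_integral_const_mul_norm_le {c : ℝ} (hc : 0 ≤ c) {f : ℝ → ℝ} {a b : ℝ}
    (ha : a ∈ Icc (0 : ℝ) 1) (hb : b ∈ Icc (0 : ℝ) 1)
    (hf : ∀ᵐ η, η ∈ Icc (0 : ℝ) 1 → |f η| ≤ c * ‖x.velocity η‖) :
    |∫ η in a..b, f η| ≤ c * (‖x‖ * √|b - a|) := by
  wlog hab : a ≤ b generalizing a b
  · rw [intervalIntegral.integral_symm, abs_neg, abs_sub_comm]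
    exact this hb ha (le_of_not_ge hab)
  rw [← Real.norm_eq_abs]
  refine (intervalIntegral.norm_integral_le_of_norm_le hab (g := fun η => c * ‖x.velocity η‖)
    ?_ ((intervalIntegrable_velocity x ha hb).norm.const_mul _)).trans ?_
  · filter_upwards [hf] with η h hη using h (Ioc_subset_Icc_unit ha hb hη)
  · rw [intervalIntegral.integral_const_mul, abs_of_nonneg (sub_nonneg.2 hab)]
    exact mul_le_mul_of_nonneg_left (integral_norm_velocity_le x ha hb hab) hc

/-- The double integral is Hölder continuous of exponent `1/2` in its endpoints. -/
lemma abs_pairIntegral_sub_le (hw : BoundedMeasurable w c) {s t s' t' : ℝ}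
    (hs : s ∈ Icc (0 : ℝ) 1) (ht : t ∈ Icc (0 : ℝ) 1) (hs' : s' ∈ Icc (0 : ℝ) 1)
    (ht' : t' ∈ Icc (0 : ℝ) 1) :
    |pairIntegral w x y s t - pairIntegral w x y s' t'| ≤
      c * (‖x‖ * ‖y‖) * (√|s - s'| + √|t - t'|) := by
  have h0 : (0 : ℝ) ∈ Icc (0 : ℝ) 1 := by simp
  have nx := SobolevPath.norm_nonneg x
  have ny := SobolevPath.norm_nonneg y
  have hc := hw.nonneg
  have hsq : ∀ {a b : ℝ}, a ∈ Icc (0 : ℝ) 1 → b ∈ Icc (0 : ℝ) 1 → √|a - b| ≤ 1 := by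
    intro a b ha hb
    rw [Real.sqrt_le_one, abs_le]
    constructor <;> linarith [ha.1, ha.2, hb.1, hb.2]
  have hin : ∀ {a b : ℝ}, a ∈ Icc (0 : ℝ) 1 → b ∈ Icc (0 : ℝ) 1 → ∀ η ∈ Icc (0 : ℝ) 1,
      |∫ τ in a..b, w η τ * inner ℝ (x.velocity η) (y.velocity τ)| ≤
        c * ‖y‖ * √|b - a| * ‖x.velocity η‖ := by
    intro a b ha hb η hη
    refine (abs_integral_const_mul_norm_le y (c := c * ‖x.velocity η‖) (by positivity) ha hb
      (Eventually.of_forall fun τ hτ => ?_)).trans (le_of_eq (by ring))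
    rw [abs_mul, mul_assoc]
    gcongr
    · exact hw.abs_le η hη τ hτ
    · exact abs_real_inner_le_norm _ _
  have h1 : |pairIntegral w x y s t - pairIntegral w x y s' t| ≤
      c * (‖x‖ * ‖y‖) * √|s - s'| := by
    rw [pairIntegral, pairIntegral, intervalIntegral.integral_interval_sub_left
      (intervalIntegrable_of_unitVol (hw.integrable_inner x y ht) h0 hs)
      (intervalIntegrable_of_unitVol (hw.integrable_inner x y ht) h0 hs')]
    refine (abs_integral_const_mul_norm_le x (c := c * ‖y‖) (by positivity) hs' hs
      (Eventually.of_forall fun η hη => ?_)).trans (le_of_eq (by ring))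
    exact (hin h0 ht η hη).trans (mul_le_mul_of_nonneg_right
      (mul_le_of_le_one_right (by positivity) (hsq ht h0)) (norm_nonneg _))
  have h2 : |pairIntegral w x y s' t - pairIntegral w x y s' t'| ≤
      c * (‖x‖ * ‖y‖) * √|t - t'| := by
    rw [pairIntegral, pairIntegral, ← intervalIntegral.integral_sub
      (intervalIntegrable_of_unitVol (hw.integrable_inner x y ht) h0 hs')
      (intervalIntegrable_of_unitVol (hw.integrable_inner x y ht') h0 hs')]
    refine (abs_integral_const_mul_norm_le x (c := c * ‖y‖ * √|t - t'|) (by positivity) h0 hs'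
      ?_).trans ?_
    · have := hw.ae_integrable x y
      rw [ae_restrict_iff' measurableSet_Icc] at this
      filter_upwards [this] with η h hη
      rw [intervalIntegral.integral_interval_sub_left (intervalIntegrable_of_unitVol (h hη) h0 ht)
        (intervalIntegrable_of_unitVol (h hη) h0 ht')]
      exact hin ht' ht η hη
    · have := hsq hs' h0
      calc _ = c * ‖y‖ * √|t - t'| * ‖x‖ * √|s' - 0| := by ring
        _ ≤ c * ‖y‖ * √|t - t'| * ‖x‖ * 1 := by gcongr
        _ = _ := by ring
  calc _ ≤ _ := abs_sub_le _ (pairIntegral w x y s' t) _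
    _ ≤ _ := add_le_add h1 h2
    _ = _ := by ring

lemma continuousOn_pairIntegral (hw : BoundedMeasurable w c) :
    ContinuousOn (fun p : ℝ × ℝ => pairIntegral w x y p.1 p.2) (Icc 0 1 ×ˢ Icc 0 1) := by
  intro p hp
  rw [ContinuousWithinAt, tendsto_iff_norm_sub_tendsto_zero]
  have hc : Tendsto (fun q : ℝ × ℝ => c * (‖x‖ * ‖y‖) * (√|q.1 - p.1| + √|q.2 - p.2|))
      (𝓝[Icc 0 1 ×ˢ Icc 0 1] p) (𝓝 0) := by
    have : Continuous fun q : ℝ × ℝ => c * (‖x‖ * ‖y‖) * (√|q.1 - p.1| + √|q.2 - p.2|) := by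
      fun_prop
    simpa using (this.tendsto p).mono_left nhdsWithin_le_nhds
  refine squeeze_zero' (Eventually.of_forall fun _ => norm_nonneg _) ?_ hc
  filter_upwards [self_mem_nhdsWithin] with q hq
  exact abs_pairIntegral_sub_le x y hw hq.1 hq.2 hp.1 hp.2

end PairIntegral

/-! ### Partitions and grid sums -/

namespace UnitPartition
variable (D : UnitPartition)

lemma idx_le (s : ℝ) : D.idx s ≤ D.size := Nat.findGreatest_le _

lemma pt_idx_le {s : ℝ} (hs : 0 ≤ s) : (D.pt (D.idx s) : ℝ) ≤ s := by
  classical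
  exact Nat.findGreatest_spec (P := fun i => (D.pt i : ℝ) ≤ s) (Nat.zero_le D.size)
    (by simpa [D.pt_zero] using hs)

lemma lt_pt_succ_idx {s : ℝ} (h : D.idx s < D.size) : s < D.pt (D.idx s + 1) := by
  classical
  exact not_le.1 (Nat.findGreatest_is_greatest (P := fun i => (D.pt i : ℝ) ≤ s)
    (Nat.lt_succ_self (D.idx s)) h)

lemma pt_mono {i j : ℕ} (hij : i ≤ j) (hj : j ≤ D.size) : D.pt i ≤ D.pt j := by
  induction j, hij using Nat.le_induction with
  | base => exact le_rfl
  | succ j _ ih => exact (ih (by omega)).trans (D.pt_lt j (by omega)).le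

lemma idx_eq {i : ℕ} (hi : i < D.size) {s : ℝ} (h1 : (D.pt i : ℝ) ≤ s)
    (h2 : s < (D.pt (i + 1) : ℝ)) : D.idx s = i := by
  classical
  refine (Nat.findGreatest_eq_iff (P := fun i => (D.pt i : ℝ) ≤ s)).2
    ⟨hi.le, fun _ => h1, fun n hn hn' => ?_⟩
  exact not_le.2 (h2.trans_le (D.pt_mono hn hn'))

lemma monotone_idx : Monotone D.idx := by
  classical
  intro s t hst
  exact Nat.findGreatest_mono (fun i hi => hi.trans hst) le_rfl

lemma mesh_nonneg : 0 ≤ D.mesh :=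
  Real.iSup_nonneg fun i => sub_nonneg.2 (D.pt_lt i i.2).le

lemma sub_pt_idx_le {s : ℝ} (hs : s ≤ 1) : s - D.pt (D.idx s) ≤ D.mesh := by
  rcases (D.idx_le s).lt_or_eq with h | h
  · refine le_trans ?_ (le_ciSup (f := fun i : Fin D.size => (D.pt (i + 1) : ℝ) - (D.pt i : ℝ))
      (finite_range _).bddAbove ⟨D.idx s, h⟩)
    simpa using (D.lt_pt_succ_idx h).le
  · rw [h, D.pt_size]
    have := D.mesh_nonneg
    simp
    linarith

lemma pt_idx_mem (s : ℝ) : (D.pt (D.idx s) : ℝ) ∈ Icc (0 : ℝ) 1 := (D.pt (D.idx s)).2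

lemma sqrt_abs_sub_pt_idx_le {s : ℝ} (hs : s ∈ Icc (0 : ℝ) 1) :
    √|(D.pt (D.idx s) : ℝ) - s| ≤ √D.mesh := by
  refine Real.sqrt_le_sqrt ?_
  rw [abs_sub_comm, abs_of_nonneg (sub_nonneg.2 (D.pt_idx_le hs.1))]
  exact D.sub_pt_idx_le hs.2

end UnitPartition

section Grid
variable {d : ℕ} (D : UnitPartition) (x y : SobolevPath d)

lemma boundedMeasurable_idx (W : ℕ → ℕ → ℝ) {c : ℝ}
    (hc : ∀ η ∈ Icc (0 : ℝ) 1, ∀ τ ∈ Icc (0 : ℝ) 1, |W (D.idx η) (D.idx τ)| ≤ c) :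
    BoundedMeasurable (fun η τ => W (D.idx η) (D.idx τ)) c := by
  refine ⟨Measurable.aestronglyMeasurable ?_, hc⟩
  have h : Measurable fun p : ℝ × ℝ => (D.idx p.1, D.idx p.2) :=
    (D.monotone_idx.measurable.comp measurable_fst).prodMk
      (D.monotone_idx.measurable.comp measurable_snd)
  exact (measurable_of_countable (fun q : ℕ × ℕ => W q.1 q.2)).comp h

lemma integrable_idx_mul_inner (g : ℕ → ℝ) (v : EuclideanSpace ℝ (Fin d)) :
    Integrable (fun τ => g (D.idx τ) * inner ℝ v (y.velocity τ)) unitVol := by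
  refine ((integrable_velocity y).const_inner v).bdd_mul
    (c := ∑ i ∈ Finset.range (D.size + 1), |g i|) ?_ (Eventually.of_forall fun τ => ?_)
  · exact ((measurable_of_countable g).comp D.monotone_idx.measurable).aestronglyMeasurable
  · exact Finset.single_le_sum (f := fun i => |g i|) (fun _ _ => abs_nonneg _)
      (Finset.mem_range.2 (Nat.lt_succ_of_le (D.idx_le τ)))

lemma integral_idx_mul_inner (g : ℕ → ℝ) (v : EuclideanSpace ℝ (Fin d)) {n : ℕ}
    (hn : n ≤ D.size) :
    ∫ τ in (0 : ℝ)..(D.pt n : ℝ), g (D.idx τ) * inner ℝ v (y.velocity τ) =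
      ∑ j ∈ Finset.range n, g j * inner ℝ v (increment D y j) := by
  have h0 : (0 : ℝ) ∈ Icc (0 : ℝ) 1 := by simp
  induction n with
  | zero => simp [D.pt_zero]
  | succ n ih =>
    have hi := integrable_idx_mul_inner D y g v
    rw [Finset.sum_range_succ, ← ih (by omega), ← intervalIntegral.integral_add_adjacent_intervals
      (intervalIntegrable_of_unitVol hi h0 (D.pt n).2)
      (intervalIntegrable_of_unitVol hi (D.pt n).2 (D.pt (n + 1)).2)]
    congr 1
    have hle : (D.pt n : ℝ) ≤ D.pt (n + 1) := (D.pt_lt n hn).le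
    have h : ∫ τ in (D.pt n : ℝ)..(D.pt (n + 1) : ℝ), g (D.idx τ) * inner ℝ v (y.velocity τ) =
        ∫ τ in (D.pt n : ℝ)..(D.pt (n + 1) : ℝ), g n * innerSL ℝ v (y.velocity τ) := by
      refine intervalIntegral.integral_congr_ae ?_
      rw [uIoc_of_le hle]
      -- The index jumps at the right endpoint, which is a null set.
      have : ∀ᵐ τ : ℝ, τ ≠ D.pt (n + 1) := compl_mem_ae_iff.2 (measure_singleton _)
      filter_upwards [this] with τ hne hτ
      rw [D.idx_eq hn hτ.1.le (lt_of_le_of_ne hτ.2 hne), innerSL_apply_apply]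
    rw [h, intervalIntegral.integral_const_mul, ContinuousLinearMap.intervalIntegral_comp_comm _
      (intervalIntegrable_velocity y (D.pt n).2 (D.pt (n + 1)).2), ← increment_eq_integral,
      innerSL_apply_apply]

lemma pairIntegral_idx (W : ℕ → ℕ → ℝ) {m n : ℕ} (hm : m ≤ D.size) (hn : n ≤ D.size) :
    pairIntegral (fun η τ => W (D.idx η) (D.idx τ)) x y (D.pt m) (D.pt n) =
      ∑ i ∈ Finset.range m, ∑ j ∈ Finset.range n,
        W i j * inner ℝ (increment D x i) (increment D y j) := by
  have h0 : (0 : ℝ) ∈ Icc (0 : ℝ) 1 := by simp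
  rw [pairIntegral, Finset.sum_comm]
  have h : ∀ η, ∫ τ in (0 : ℝ)..(D.pt n : ℝ),
      W (D.idx η) (D.idx τ) * inner ℝ (x.velocity η) (y.velocity τ) =
      ∑ j ∈ Finset.range n, W (D.idx η) j * inner ℝ (increment D y j) (x.velocity η) := by
    intro η
    rw [integral_idx_mul_inner D y (W (D.idx η)) _ hn]
    simp_rw [real_inner_comm]
  simp_rw [h]
  rw [intervalIntegral.integral_finsetSum fun j _ => intervalIntegrable_of_unitVol
    (integrable_idx_mul_inner D x (fun i => W i j) (increment D y j)) h0 (D.pt m).2]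
  refine Finset.sum_congr rfl fun j _ => ?_
  rw [integral_idx_mul_inner D x (fun i => W i j) _ hm]
  simp_rw [real_inner_comm]

end Grid

/-- An estimate `f ≤ N ω` which improves itself to `f ≤ (ε + N / 2) ω` holds with the fixed point
`N = 2 ε`, whatever the a priori bound `N₀` is. -/
lemma le_of_contraction {α : Type*} {P : α → Prop} {f ω : α → ℝ} {ε N₀ : ℝ} (hε : 0 ≤ ε)
    (hN₀ : 0 ≤ N₀) (hω : ∀ i, 0 ≤ ω i) (h₀ : ∀ i, P i → f i ≤ N₀ * ω i)
    (h : ∀ N, 0 ≤ N → (∀ i, P i → f i ≤ N * ω i) → ∀ i, P i → f i ≤ (ε + N / 2) * ω i) :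
    ∀ i, P i → f i ≤ 2 * ε * ω i := by
  have key : ∀ k : ℕ, ∀ i, P i → f i ≤ (2 * ε + N₀ * (1 / 2) ^ k) * ω i := by
    intro k
    induction k with
    | zero =>
      intro i hi
      refine (h₀ i hi).trans (mul_le_mul_of_nonneg_right ?_ (hω i))
      simp
      linarith
    | succ k ih =>
      intro i hi
      have := h _ (by positivity) ih i hi
      convert this using 2
      rw [pow_succ]; ring
  intro i hi
  have hlim : Tendsto (fun k : ℕ => (2 * ε + N₀ * (1 / 2) ^ k) * ω i) atTop
      (𝓝 ((2 * ε + N₀ * 0) * ω i)) :=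
    ((tendsto_pow_atTop_nhds_zero_of_lt_one (by norm_num) (by norm_num)).const_mul N₀
      |>.const_add _).mul_const _
  rw [mul_zero, add_zero] at hlim
  exact ge_of_tendsto' hlim fun k => key k i hi

/-- The rate `l` of the exponential weight is chosen such that a given constant is halved. -/
lemma exists_rate (B : ℝ) : ∃ l, 0 < l ∧ B / √(2 * l) ≤ 1 / 2 := by
  refine ⟨2 * B ^ 2 + 1, by positivity, ?_⟩
  rw [div_le_iff₀ (by positivity)]
  have : 2 * B ≤ √(2 * (2 * B ^ 2 + 1)) := Real.le_sqrt_of_sq_le (by nlinarith [sq_nonneg B])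
  linarith

/-! ### Bounds and stability of the interpolated kernels -/

section Kernels
variable {φ : ℝ → ℝ} {σa σA σb : ℝ} {d : ℕ}

/-- The factor `σ_A² V_φ(Σ^{x,y}(s,t)) + σ_b²` in the density of the Goursat problem. -/
noncomputable def coeff (φ : ℝ → ℝ) (σA σb : ℝ) (K : SobolevPath d → SobolevPath d → ℝ → ℝ → ℝ)
    (x y : SobolevPath d) (s t : ℝ) : ℝ :=
  σA ^ 2 * V φ (covMat K x y s t) + σb ^ 2

/-- The covariance matrices of the family `K` are admissible at `(x, s)` and `(y, t)`. -/
def AdmissibleAt (σa : ℝ) (K : SobolevPath d → SobolevPath d → ℝ → ℝ → ℝ) (x y : SobolevPath d)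
    (s t : ℝ) : Prop :=
  Admissible σa (K x x s s) (K y y t t) (K x y s t)

lemma interpKernel_eq (D : UnitPartition) (x y : SobolevPath d) (s t : ℝ) :
    interpKernel φ σa σA σb D x y s t =
      σa ^ 2 + pairIntegral (coeff φ σA σb (stepKernel φ σa σA σb D) x y) x y s t :=
  rfl

lemma exists_abs_coeff_le (hlin : LinearlyBounded φ) (hac : ACWithExpBoundedDeriv φ)
    (σa σA σb : ℝ) :
    ∃ A, 0 ≤ A ∧ ∀ (K : SobolevPath d → SobolevPath d → ℝ → ℝ → ℝ) x y s t,
      AdmissibleAt σa K x y s t → |coeff φ σA σb K x y s t| ≤ A * (2 + K x x s s + K y y t t) := by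
  obtain ⟨A, hA, h⟩ := exists_abs_V_le hac.continuous hlin
  refine ⟨σA ^ 2 * A + σb ^ 2, by positivity, fun K x y s t hK => ?_⟩
  have h1 := h _ _ _ _ hK
  have h2 := (sq_nonneg _).trans hK.left
  have h3 := (sq_nonneg _).trans hK.right
  calc |coeff φ σA σb K x y s t| ≤ |σA ^ 2 * V φ (covMat K x y s t)| + |σb ^ 2| := abs_add_le _ _
    _ ≤ σA ^ 2 * (A * (2 + K x x s s + K y y t t)) + σb ^ 2 * (2 + K x x s s + K y y t t) := by
        rw [abs_mul, abs_of_nonneg (sq_nonneg σA), abs_of_nonneg (sq_nonneg σb)]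
        gcongr
        · exact h1
        · exact le_mul_of_one_le_right (sq_nonneg _) (by linarith)
    _ = _ := by ring

lemma exists_abs_coeff_sub_le (hlin : LinearlyBounded φ) (hac : ACWithExpBoundedDeriv φ)
    (hσa : 0 < σa) (σA σb R : ℝ) :
    ∃ L, 0 ≤ L ∧ ∀ (K K' : SobolevPath d → SobolevPath d → ℝ → ℝ → ℝ) x y s t s' t',
      AdmissibleAt σa K x y s t → AdmissibleAt σa K' x y s' t' →
      K x x s s ≤ R → K y y t t ≤ R → K' x x s' s' ≤ R → K' y y t' t' ≤ R →
      |coeff φ σA σb K x y s t - coeff φ σA σb K' x y s' t'| ≤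
        L * (|K x x s s - K' x x s' s'| + |K y y t t - K' y y t' t'|
          + |K x y s t - K' x y s' t'|) := by
  obtain ⟨L, hL, h⟩ := exists_abs_V_sub_le hlin hac hσa R
  refine ⟨σA ^ 2 * L, by positivity, fun K K' x y s t s' t' hK hK' h1 h2 h3 h4 => ?_⟩
  have h5 := h _ _ _ _ _ _ hK hK' h1 h2 h3 h4
  rw [coeff, coeff, add_sub_add_right_eq_sub, ← mul_sub, abs_mul, abs_of_nonneg (sq_nonneg σA),
    mul_assoc]
  exact mul_le_mul_of_nonneg_left h5 (sq_nonneg _)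

lemma admissibleAt_stepKernel (hlin : LinearlyBounded φ) (hac : ACWithExpBoundedDeriv φ)
    (D : UnitPartition) (x y : SobolevPath d) (s t : ℝ) :
    AdmissibleAt σa (stepKernel φ σa σA σb D) x y s t :=
  admissible_discreteKernel σa σA σb D hac.continuous hlin x y _ _

lemma coeff_stepKernel (D : UnitPartition) (x y : SobolevPath d) :
    coeff φ σA σb (stepKernel φ σa σA σb D) x y =
      fun η τ => discreteCoeff φ σa σA σb D x y (D.idx η) (D.idx τ) :=
  rfl

/-- The step kernel takes the values of the interpolated kernel at the grid points. -/
lemma stepKernel_eq_interpKernel (D : UnitPartition) (x y : SobolevPath d) (s t : ℝ) :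
    stepKernel φ σa σA σb D x y s t =
      interpKernel φ σa σA σb D x y (D.pt (D.idx s)) (D.pt (D.idx t)) := by
  rw [interpKernel_eq, coeff_stepKernel, pairIntegral_idx D x y
    (discreteCoeff φ σa σA σb D x y) (D.idx_le s) (D.idx_le t), stepKernel,
    discreteKernel_eq_sum]

lemma AdmissibleAt.abs_le {K : SobolevPath d → SobolevPath d → ℝ → ℝ → ℝ} {x y : SobolevPath d}
    {s t R : ℝ} (h : AdmissibleAt σa K x y s t) (hx : K x x s s ≤ R) (hy : K y y t t ≤ R) :
    |K x y s t| ≤ R := by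
  have h2 := (sq_nonneg _).trans h.left
  have h3 := (sq_nonneg _).trans h.right
  refine abs_le_of_sq_le_sq (h.sq_le.trans ?_) (h2.trans hx)
  rw [sq]
  exact mul_le_mul hx hy h3 (h2.trans hx)

/-- A bound for the variances of the step kernels which is uniform over all partitions. -/
theorem exists_stepKernel_le (hlin : LinearlyBounded φ) (hac : ACWithExpBoundedDeriv φ)
    (σa σA σb r : ℝ) :
    ∃ R, 0 ≤ R ∧ ∀ (D : UnitPartition) (x : SobolevPath d), ‖x‖ ≤ r → ∀ s ∈ Icc (0 : ℝ) 1,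
      stepKernel φ σa σA σb D x x s s ≤ R := by
  obtain ⟨A, hA, hcoeff⟩ := exists_abs_coeff_le (d := d) hlin hac σa σA σb
  obtain ⟨l, hl, hB⟩ := exists_rate (2 * A * r ^ 2)
  refine ⟨2 * (1 + σa ^ 2) * Real.exp l, by positivity, fun D x hx => ?_⟩
  set S := stepKernel φ σa σA σb D x x with hS
  have hr : 0 ≤ r := (SobolevPath.norm_nonneg x).trans hx
  have hadm := fun s => admissibleAt_stepKernel (σa := σa) (σA := σA) (σb := σb) hlin hac D x x s s
  have hS0 : ∀ s, 0 ≤ S s s := fun s => (sq_nonneg _).trans (hadm s).left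
  -- The a priori bound `N₀` depends on the partition, which does no harm.
  have key := le_of_contraction (P := fun s : ℝ => s ∈ Icc (0 : ℝ) 1) (f := fun s => 1 + S s s)
    (ω := fun s => Real.exp (l * s)) (ε := 1 + σa ^ 2)
    (N₀ := 1 + ∑ m ∈ Finset.range (D.size + 1), |discreteKernel φ σa σA σb D x x m m|)
    (by positivity) (by positivity) (fun s => (Real.exp_pos _).le) ?_ ?_
  · intro s hs
    have h1 := key s hs
    have h2 : Real.exp (l * s) ≤ Real.exp l :=
      Real.exp_le_exp.2 (mul_le_of_le_one_right hl.le hs.2)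
    have h3 : 2 * (1 + σa ^ 2) * Real.exp (l * s) ≤ 2 * (1 + σa ^ 2) * Real.exp l := by gcongr
    linarith
  · intro s hs
    have h1 : S s s ≤ ∑ m ∈ Finset.range (D.size + 1), |discreteKernel φ σa σA σb D x x m m| :=
      (le_abs_self _).trans (Finset.single_le_sum
        (f := fun m => |discreteKernel φ σa σA σb D x x m m|) (fun _ _ => abs_nonneg _)
        (Finset.mem_range.2 (Nat.lt_succ_of_le (D.idx_le s))))
    have h2 : 1 ≤ Real.exp (l * s) := Real.one_le_exp (mul_nonneg hl.le hs.1)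
    refine le_trans ?_ (le_mul_of_one_le_right (by positivity) h2)
    simpa using h1
  · intro N hN hf s hs
    have hc : ∀ η ∈ Icc (0 : ℝ) 1, ∀ τ ∈ Icc (0 : ℝ) 1,
        |coeff φ σA σb (stepKernel φ σa σA σb D) x x η τ| ≤
          0 + A * N * (Real.exp (l * η) + Real.exp (l * τ)) := by
      intro η hη τ hτ
      refine (hcoeff _ x x η τ (admissibleAt_stepKernel hlin hac D x x η τ)).trans ?_
      have e1 := hf η hη
      have e2 := hf τ hτ
      simp only [hS] at e1 e2
      rw [zero_add, mul_assoc]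
      refine mul_le_mul_of_nonneg_left ?_ hA
      linarith
    have hfl := D.pt_idx_mem s
    have h1 := abs_pairIntegral_le x x le_rfl (mul_nonneg hA hN) hl hc hfl hfl
    have h2 : Real.exp (l * D.pt (D.idx s)) ≤ Real.exp (l * s) :=
      Real.exp_le_exp.2 (mul_le_mul_of_nonneg_left (D.pt_idx_le hs.1) hl.le)
    have h3 : S s s ≤ σa ^ 2 + N / 2 * Real.exp (l * s) := by
      rw [hS, stepKernel_eq_interpKernel, interpKernel_eq]
      gcongr
      refine (le_abs_self _).trans (h1.trans ?_)
      have hx2 : ‖x‖ * ‖x‖ ≤ r ^ 2 := by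
        rw [sq]
        exact mul_le_mul hx hx (SobolevPath.norm_nonneg x) hr
      calc _ = (‖x‖ * ‖x‖) * (2 * A * N * (Real.exp (l * D.pt (D.idx s)) / √(2 * l))) := by ring
        _ ≤ r ^ 2 * (2 * A * N * (Real.exp (l * s) / √(2 * l))) := by gcongr
        _ = (2 * A * r ^ 2 / √(2 * l)) * (N * Real.exp (l * s)) := by ring
        _ ≤ 1 / 2 * (N * Real.exp (l * s)) := by gcongr
        _ = _ := by ring
    have h4 : 1 ≤ Real.exp (l * s) := Real.one_le_exp (mul_nonneg hl.le hs.1)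
    nlinarith [sq_nonneg σa]

/-- The constants `R` and `c` bound the variances and the coefficients of all step kernels of paths
of norm at most `r`. -/
theorem exists_boundedMeasurable_coeff (hlin : LinearlyBounded φ) (hac : ACWithExpBoundedDeriv φ)
    (σa σA σb r : ℝ) :
    ∃ R c, 0 ≤ R ∧ 0 ≤ c ∧
      (∀ (D : UnitPartition) (x : SobolevPath d), ‖x‖ ≤ r → ∀ s ∈ Icc (0 : ℝ) 1,
        stepKernel φ σa σA σb D x x s s ≤ R) ∧
      ∀ (D : UnitPartition) (x y : SobolevPath d), ‖x‖ ≤ r → ‖y‖ ≤ r →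
        BoundedMeasurable (coeff φ σA σb (stepKernel φ σa σA σb D) x y) c := by
  obtain ⟨A, hA, hcoeff⟩ := exists_abs_coeff_le (d := d) hlin hac σa σA σb
  obtain ⟨R, hR, hS⟩ := exists_stepKernel_le (d := d) hlin hac σa σA σb r
  refine ⟨R, A * (2 + R + R), hR, by positivity, hS, fun D x y hx hy => ?_⟩
  rw [coeff_stepKernel]
  refine boundedMeasurable_idx D _ fun η hη τ hτ => ?_
  refine (hcoeff _ x y η τ (admissibleAt_stepKernel hlin hac D x y η τ)).trans ?_
  have := hS D x hx η hη
  have := hS D y hy τ hτ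
  gcongr

lemma continuousOn_interpKernel (hlin : LinearlyBounded φ) (hac : ACWithExpBoundedDeriv φ)
    (D : UnitPartition) (x y : SobolevPath d) :
    ContinuousOn (fun p : ℝ × ℝ => interpKernel φ σa σA σb D x y p.1 p.2)
      (Icc 0 1 ×ˢ Icc 0 1) := by
  obtain ⟨R, c, -, -, -, hc⟩ :=
    exists_boundedMeasurable_coeff (d := d) hlin hac σa σA σb (max ‖x‖ ‖y‖)
  simp_rw [interpKernel_eq]
  exact continuousOn_const.add
    (continuousOn_pairIntegral x y (hc D x y (le_max_left _ _) (le_max_right _ _)))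

/-- The step kernel is the interpolated kernel at the grid point below, so that Hölder continuity
bounds the difference. -/
lemma abs_stepKernel_sub_interpKernel_le {D : UnitPartition} {x y : SobolevPath d} {c r : ℝ}
    (hx : ‖x‖ ≤ r) (hy : ‖y‖ ≤ r)
    (hc : BoundedMeasurable (coeff φ σA σb (stepKernel φ σa σA σb D) x y) c) {s t : ℝ}
    (hs : s ∈ Icc (0 : ℝ) 1) (ht : t ∈ Icc (0 : ℝ) 1) :
    |stepKernel φ σa σA σb D x y s t - interpKernel φ σa σA σb D x y s t| ≤
      2 * c * r ^ 2 * √D.mesh := by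
  rw [stepKernel_eq_interpKernel, interpKernel_eq, interpKernel_eq, add_sub_add_left_eq_sub]
  refine (abs_pairIntegral_sub_le x y hc (D.pt_idx_mem s) (D.pt_idx_mem t) hs ht).trans ?_
  have h1 := D.sqrt_abs_sub_pt_idx_le hs
  have h2 := D.sqrt_abs_sub_pt_idx_le ht
  have nx := SobolevPath.norm_nonneg x
  have ny := SobolevPath.norm_nonneg y
  have hc0 := hc.nonneg
  calc _ ≤ c * (r * r) * (√D.mesh + √D.mesh) := by have := nx.trans hx; gcongr
    _ = _ := by ring

/-- The interpolated kernels of two partitions differ by at most the square roots of the meshes: a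
Grönwall argument in the norm with weight `e^{-l max(s,t)}`, simultaneously for all pairs of paths
in a ball. -/
theorem exists_abs_interpKernel_sub_le (hlin : LinearlyBounded φ) (hac : ACWithExpBoundedDeriv φ)
    (hσa : 0 < σa) (σA σb r : ℝ) :
    ∃ C, 0 ≤ C ∧ ∀ (D D' : UnitPartition) (x y : SobolevPath d), ‖x‖ ≤ r → ‖y‖ ≤ r →
      ∀ s ∈ Icc (0 : ℝ) 1, ∀ t ∈ Icc (0 : ℝ) 1,
        |interpKernel φ σa σA σb D x y s t - interpKernel φ σa σA σb D' x y s t| ≤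
          C * (√D.mesh + √D'.mesh) := by
  obtain ⟨R, c, hR, hc, hSR, hbm⟩ := exists_boundedMeasurable_coeff (d := d) hlin hac σa σA σb r
  obtain ⟨L, hL, hcoeff⟩ := exists_abs_coeff_sub_le (d := d) hlin hac hσa σA σb R
  obtain ⟨l, hl, hB⟩ := exists_rate (4 * L * r ^ 2)
  refine ⟨4 * c * r ^ 2 * Real.exp l + 2 * c * r ^ 2, by positivity, fun D D' => ?_⟩
  set m := √D.mesh + √D'.mesh with hm
  have hm0 : 0 ≤ m := by positivity
  set S := stepKernel (d := d) φ σa σA σb D with hS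
  set S' := stepKernel (d := d) φ σa σA σb D' with hS'
  have hstep : ∀ x y : SobolevPath d, ‖x‖ ≤ r → ‖y‖ ≤ r → ∀ s ∈ Icc (0 : ℝ) 1,
      ∀ t ∈ Icc (0 : ℝ) 1,
      |(S x y s t - S' x y s t) - (interpKernel φ σa σA σb D x y s t
        - interpKernel φ σa σA σb D' x y s t)| ≤ 2 * c * r ^ 2 * m := by
    intro x y hx hy s hs t ht
    have h1 := abs_stepKernel_sub_interpKernel_le hx hy (hbm D x y hx hy) hs ht
    have h2 := abs_stepKernel_sub_interpKernel_le hx hy (hbm D' x y hx hy) hs ht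
    rw [sub_sub_sub_comm]
    refine (abs_sub _ _).trans ?_
    rw [hm, mul_add]
    exact add_le_add h1 h2
  have key := le_of_contraction
    (P := fun q : (SobolevPath d × SobolevPath d) × ℝ × ℝ => ‖q.1.1‖ ≤ r ∧ ‖q.1.2‖ ≤ r ∧
      q.2.1 ∈ Icc (0 : ℝ) 1 ∧ q.2.2 ∈ Icc (0 : ℝ) 1)
    (f := fun q => |S q.1.1 q.1.2 q.2.1 q.2.2 - S' q.1.1 q.1.2 q.2.1 q.2.2|)
    (ω := fun q => Real.exp (l * max q.2.1 q.2.2)) (ε := 2 * c * r ^ 2 * m) (N₀ := 2 * R)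
    (by positivity) (by positivity) (fun s => (Real.exp_pos _).le) ?_ ?_
  · intro x y hx hy s hs t ht
    have h1 := key ((x, y), (s, t)) ⟨hx, hy, hs, ht⟩
    simp only at h1
    have h2 := hstep x y hx hy s hs t ht
    have h3 : Real.exp (l * max s t) ≤ Real.exp l :=
      Real.exp_le_exp.2 (mul_le_of_le_one_right hl.le (max_le hs.2 ht.2))
    have h4 : 2 * (2 * c * r ^ 2 * m) * Real.exp (l * max s t) ≤
        2 * (2 * c * r ^ 2 * m) * Real.exp l := by gcongr
    have h5 := abs_sub_abs_le_abs_sub (interpKernel φ σa σA σb D x y s t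
        - interpKernel φ σa σA σb D' x y s t) (S x y s t - S' x y s t)
    rw [abs_sub_comm (interpKernel φ σa σA σb D x y s t
        - interpKernel φ σa σA σb D' x y s t)] at h5
    calc _ ≤ 2 * (2 * c * r ^ 2 * m) * Real.exp l + 2 * c * r ^ 2 * m := by linarith
      _ = _ := by ring
  · rintro ⟨⟨x, y⟩, s, t⟩ ⟨hx, hy, hs, ht⟩
    have h1 := (admissibleAt_stepKernel (σa := σa) (σA := σA) (σb := σb) hlin hac D x y s t).abs_le
      (hSR D x hx s hs) (hSR D y hy t ht)
    have h2 := (admissibleAt_stepKernel (σa := σa) (σA := σA) (σb := σb) hlin hac D' x y s t).abs_le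
      (hSR D' x hx s hs) (hSR D' y hy t ht)
    have h3 : 1 ≤ Real.exp (l * max s t) :=
      Real.one_le_exp (mul_nonneg hl.le (le_max_of_le_left hs.1))
    refine le_trans ?_ (le_mul_of_one_le_right (by positivity) h3)
    refine (abs_sub _ _).trans ?_
    simp only [hS, hS']
    linarith
  · rintro N hN hf ⟨⟨x, y⟩, s, t⟩ ⟨hx, hy, hs, ht⟩
    have hw : ∀ η ∈ Icc (0 : ℝ) 1, ∀ τ ∈ Icc (0 : ℝ) 1,
        |coeff φ σA σb S x y η τ - coeff φ σA σb S' x y η τ| ≤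
          0 + 2 * L * N * (Real.exp (l * η) + Real.exp (l * τ)) := by
      intro η hη τ hτ
      refine (hcoeff S S' x y η τ η τ (admissibleAt_stepKernel hlin hac D x y η τ)
        (admissibleAt_stepKernel hlin hac D' x y η τ) (hSR D x hx η hη) (hSR D y hy τ hτ)
        (hSR D' x hx η hη) (hSR D' y hy τ hτ)).trans ?_
      have e1 := hf ((x, x), (η, η)) ⟨hx, hx, hη, hη⟩
      have e2 := hf ((y, y), (τ, τ)) ⟨hy, hy, hτ, hτ⟩
      have e3 := hf ((x, y), (η, τ)) ⟨hx, hy, hη, hτ⟩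
      simp only [max_self] at e1 e2 e3
      have e4 : Real.exp (l * max η τ) ≤ Real.exp (l * η) + Real.exp (l * τ) := by
        rcases max_choice η τ with h | h <;> rw [h] <;>
          linarith [Real.exp_pos (l * η), Real.exp_pos (l * τ)]
      have e5 := mul_le_mul_of_nonneg_left e4 hN
      rw [zero_add, show 2 * L * N * (Real.exp (l * η) + Real.exp (l * τ)) =
        L * (2 * N * (Real.exp (l * η) + Real.exp (l * τ))) by ring]
      refine mul_le_mul_of_nonneg_left ?_ hL
      linarith
    have h1 := abs_pairIntegral_le x y le_rfl (by positivity) hl hw hs ht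
    rw [← pairIntegral_sub x y (hbm D x y hx hy) (hbm D' x y hx hy) hs ht] at h1
    have h2 := hstep x y hx hy s hs t ht
    rw [interpKernel_eq, interpKernel_eq, add_sub_add_left_eq_sub] at h2
    have hE1 : Real.exp (l * s) ≤ Real.exp (l * max s t) := by gcongr; exact le_max_left _ _
    have hE2 : Real.exp (l * t) ≤ Real.exp (l * max s t) := by gcongr; exact le_max_right _ _
    have hr : 0 ≤ r := (SobolevPath.norm_nonneg x).trans hx
    have h3 : ‖x‖ * ‖y‖ * (0 + 2 * L * N * ((Real.exp (l * s) + Real.exp (l * t)) / √(2 * l))) ≤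
        N / 2 * Real.exp (l * max s t) := by
      calc _ ≤ r * r * (0 + 2 * L * N *
            ((Real.exp (l * max s t) + Real.exp (l * max s t)) / √(2 * l))) := by
            gcongr
            exact SobolevPath.norm_nonneg y
        _ = (4 * L * r ^ 2 / √(2 * l)) * (N * Real.exp (l * max s t)) := by ring
        _ ≤ 1 / 2 * (N * Real.exp (l * max s t)) := by gcongr
        _ = _ := by ring
    have h4 : 1 ≤ Real.exp (l * max s t) :=
      Real.one_le_exp (mul_nonneg hl.le (le_max_of_le_left hs.1))
    have h5 : 2 * c * r ^ 2 * m ≤ 2 * c * r ^ 2 * m * Real.exp (l * max s t) :=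
      le_mul_of_one_le_right (by positivity) h4
    have h6 := abs_sub_abs_le_abs_sub (S x y s t - S' x y s t)
      (pairIntegral (coeff φ σA σb S x y) x y s t - pairIntegral (coeff φ σA σb S' x y) x y s t)
    simp only
    rw [add_mul]
    linarith

end Kernels

/-! ### The limit kernel -/

section Uniform

/-- The partition of `[0,1]` into `k + 1` intervals of equal length. -/
noncomputable def uniformPartition (k : ℕ) : UnitPartition where
  size := k + 1
  pt i := projIcc 0 1 zero_le_one ((i : ℝ) / (k + 1))
  pt_zero := by simp [projIcc_left]
  pt_size := by
    rw [Nat.cast_add, Nat.cast_one, div_self (by positivity)]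
    exact projIcc_right _
  pt_lt i hi := by
    have hk : (0 : ℝ) < k + 1 := by positivity
    have hi' : (i : ℝ) + 1 ≤ k + 1 := by exact_mod_cast hi
    refine strictMonoOn_projIcc zero_le_one ⟨by positivity, ?_⟩ ⟨by positivity, ?_⟩ ?_
    · rw [div_le_one hk]; linarith
    · rw [div_le_one hk]; push_cast; linarith
    · push_cast
      gcongr
      linarith

lemma mesh_uniformPartition_le (k : ℕ) : (uniformPartition k).mesh ≤ 1 / ((k : ℝ) + 1) := by
  have hk : (0 : ℝ) < k + 1 := by positivity
  have : Nonempty (Fin (uniformPartition k).size) := ⟨⟨0, Nat.succ_pos k⟩⟩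
  refine ciSup_le fun i => ?_
  have hi : (i : ℕ) + 1 ≤ k + 1 := i.2
  have hi' : ((i : ℕ) : ℝ) + 1 ≤ k + 1 := by exact_mod_cast hi
  have e : ∀ j : ℕ, (j : ℝ) ≤ k + 1 → ((uniformPartition k).pt j : ℝ) = (j : ℝ) / (k + 1) := by
    intro j hj
    exact congrArg Subtype.val (projIcc_of_mem zero_le_one
      (x := (j : ℝ) / (k + 1)) ⟨by positivity, by rwa [div_le_one hk]⟩)
  rw [e _ (by push_cast; exact hi'), e _ (by linarith), ← sub_div]
  push_cast
  simp

lemma tendsto_sqrt_mesh_uniformPartition :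
    Tendsto (fun k => √(uniformPartition k).mesh) atTop (𝓝 0) := by
  have h : Tendsto (fun k => (uniformPartition k).mesh) atTop (𝓝 0) :=
    squeeze_zero (fun k => (uniformPartition k).mesh_nonneg) mesh_uniformPartition_le
      tendsto_one_div_add_atTop_nhds_zero_nat
  simpa using h.sqrt

end Uniform

section Limit
variable {φ : ℝ → ℝ} {σa : ℝ} (σA σb : ℝ) {d : ℕ}

/-- The limit of the interpolated kernels along the uniform partitions. It exists on the unit
square; elsewhere the value is arbitrary. -/
noncomputable def limitKernel (φ : ℝ → ℝ) (σa σA σb : ℝ) (x y : SobolevPath d) (s t : ℝ) : ℝ :=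
  limUnder atTop fun k => interpKernel φ σa σA σb (uniformPartition k) x y s t

lemma tendsto_limitKernel (hlin : LinearlyBounded φ) (hac : ACWithExpBoundedDeriv φ)
    (hσa : 0 < σa) (x y : SobolevPath d) {s t : ℝ} (hs : s ∈ Icc (0 : ℝ) 1)
    (ht : t ∈ Icc (0 : ℝ) 1) :
    Tendsto (fun k => interpKernel φ σa σA σb (uniformPartition k) x y s t) atTop
      (𝓝 (limitKernel φ σa σA σb x y s t)) := by
  obtain ⟨C, hC, h⟩ := exists_abs_interpKernel_sub_le (d := d) hlin hac hσa σA σb (max ‖x‖ ‖y‖)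
  refine CauchySeq.tendsto_limUnder (cauchySeq_of_le_tendsto_0
    (fun N : ℕ => C * (√(1 / ((N : ℝ) + 1)) + √(1 / ((N : ℝ) + 1)))) (fun n m N hn hm => ?_) ?_)
  · rw [Real.dist_eq]
    refine (h _ _ x y (le_max_left _ _) (le_max_right _ _) s hs t ht).trans ?_
    have e : ∀ n, N ≤ n → (uniformPartition n).mesh ≤ 1 / ((N : ℝ) + 1) := fun n hn =>
      (mesh_uniformPartition_le n).trans (by gcongr)
    gcongr
    · exact e n hn
    · exact e m hm
  · have h1 : Tendsto (fun N : ℕ => √(1 / ((N : ℝ) + 1))) atTop (𝓝 0) := by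
      simpa using (tendsto_one_div_add_atTop_nhds_zero_nat (𝕜 := ℝ)).sqrt
    simpa using (h1.add h1).const_mul C

/-- The rate of convergence of the interpolated kernels. -/
theorem exists_abs_interpKernel_sub_limitKernel_le (hlin : LinearlyBounded φ)
    (hac : ACWithExpBoundedDeriv φ) (hσa : 0 < σa) (r : ℝ) :
    ∃ C, 0 ≤ C ∧ ∀ (D : UnitPartition) (x y : SobolevPath d), ‖x‖ ≤ r → ‖y‖ ≤ r →
      ∀ s ∈ Icc (0 : ℝ) 1, ∀ t ∈ Icc (0 : ℝ) 1,
        |interpKernel φ σa σA σb D x y s t - limitKernel φ σa σA σb x y s t| ≤ C * √D.mesh := by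
  obtain ⟨C, hC, h⟩ := exists_abs_interpKernel_sub_le (d := d) hlin hac hσa σA σb r
  refine ⟨C, hC, fun D x y hx hy s hs t ht => ?_⟩
  have h1 := ((tendsto_limitKernel σA σb hlin hac hσa x y hs ht).const_sub
    (interpKernel φ σa σA σb D x y s t)).abs
  have h2 : Tendsto (fun k => C * (√D.mesh + √(uniformPartition k).mesh)) atTop
      (𝓝 (C * (√D.mesh + 0))) := (tendsto_sqrt_mesh_uniformPartition.const_add _).const_mul C
  rw [add_zero] at h2
  exact le_of_tendsto_of_tendsto' h1 h2 fun k => h D (uniformPartition k) x y hx hy s hs t ht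

lemma exists_abs_stepKernel_sub_limitKernel_le (hlin : LinearlyBounded φ)
    (hac : ACWithExpBoundedDeriv φ) (hσa : 0 < σa) (r : ℝ) :
    ∃ C, 0 ≤ C ∧ ∀ (D : UnitPartition) (x y : SobolevPath d), ‖x‖ ≤ r → ‖y‖ ≤ r →
      ∀ s ∈ Icc (0 : ℝ) 1, ∀ t ∈ Icc (0 : ℝ) 1,
        |stepKernel φ σa σA σb D x y s t - limitKernel φ σa σA σb x y s t| ≤ C * √D.mesh := by
  obtain ⟨C, hC, h⟩ := exists_abs_interpKernel_sub_limitKernel_le (d := d) σA σb hlin hac hσa r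
  obtain ⟨R, c, hR, hc, -, hbm⟩ := exists_boundedMeasurable_coeff (d := d) hlin hac σa σA σb r
  refine ⟨2 * c * r ^ 2 + C, by positivity, fun D x y hx hy s hs t ht => ?_⟩
  refine (abs_sub_le _ (interpKernel φ σa σA σb D x y s t) _).trans ?_
  rw [add_mul]
  exact add_le_add (abs_stepKernel_sub_interpKernel_le hx hy (hbm D x y hx hy) hs ht)
    (h D x y hx hy s hs t ht)

lemma tendsto_stepKernel (hlin : LinearlyBounded φ) (hac : ACWithExpBoundedDeriv φ)
    (hσa : 0 < σa) (x y : SobolevPath d) {s t : ℝ} (hs : s ∈ Icc (0 : ℝ) 1)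
    (ht : t ∈ Icc (0 : ℝ) 1) :
    Tendsto (fun k => stepKernel φ σa σA σb (uniformPartition k) x y s t) atTop
      (𝓝 (limitKernel φ σa σA σb x y s t)) := by
  obtain ⟨C, hC, h⟩ := exists_abs_stepKernel_sub_limitKernel_le (d := d) σA σb hlin hac hσa
    (max ‖x‖ ‖y‖)
  rw [tendsto_iff_norm_sub_tendsto_zero]
  refine squeeze_zero (fun _ => norm_nonneg _)
    (fun k => h _ x y (le_max_left _ _) (le_max_right _ _) s hs t ht) ?_
  simpa using tendsto_sqrt_mesh_uniformPartition.const_mul C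

lemma admissibleAt_limitKernel (hlin : LinearlyBounded φ) (hac : ACWithExpBoundedDeriv φ)
    (hσa : 0 < σa) (x y : SobolevPath d) {s t : ℝ} (hs : s ∈ Icc (0 : ℝ) 1)
    (ht : t ∈ Icc (0 : ℝ) 1) : AdmissibleAt σa (limitKernel φ σa σA σb) x y s t := by
  have h := fun k => admissibleAt_stepKernel (σa := σa) (σA := σA) (σb := σb) hlin hac
    (uniformPartition k) x y s t
  have h1 := tendsto_stepKernel σA σb hlin hac hσa x x hs hs
  have h2 := tendsto_stepKernel σA σb hlin hac hσa y y ht ht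
  have h3 := tendsto_stepKernel σA σb hlin hac hσa x y hs ht
  exact ⟨ge_of_tendsto' h1 fun k => (h k).left, ge_of_tendsto' h2 fun k => (h k).right,
    le_of_tendsto_of_tendsto' (h3.pow 2) (h1.mul h2) fun k => (h k).sq_le⟩

lemma exists_limitKernel_le (hlin : LinearlyBounded φ) (hac : ACWithExpBoundedDeriv φ)
    (hσa : 0 < σa) (r : ℝ) :
    ∃ R, ∀ x : SobolevPath d, ‖x‖ ≤ r → ∀ s ∈ Icc (0 : ℝ) 1,
      limitKernel φ σa σA σb x x s s ≤ R := by
  obtain ⟨R, hR, h⟩ := exists_stepKernel_le (d := d) hlin hac σa σA σb r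
  exact ⟨R, fun x hx s hs => le_of_tendsto' (tendsto_stepKernel σA σb hlin hac hσa x x hs hs)
    fun k => h _ x hx s hs⟩

lemma continuousOn_limitKernel (hlin : LinearlyBounded φ) (hac : ACWithExpBoundedDeriv φ)
    (hσa : 0 < σa) (x y : SobolevPath d) :
    ContinuousOn (fun p : ℝ × ℝ => limitKernel φ σa σA σb x y p.1 p.2) (Icc 0 1 ×ˢ Icc 0 1) := by
  obtain ⟨C, hC, h⟩ := exists_abs_interpKernel_sub_limitKernel_le (d := d) σA σb hlin hac hσa
    (max ‖x‖ ‖y‖)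
  have hu : TendstoUniformlyOn
      (fun k (p : ℝ × ℝ) => interpKernel φ σa σA σb (uniformPartition k) x y p.1 p.2)
      (fun p => limitKernel φ σa σA σb x y p.1 p.2) atTop (Icc 0 1 ×ˢ Icc 0 1) := by
    rw [Metric.tendstoUniformlyOn_iff]
    intro ε hε
    have h1 : Tendsto (fun k => C * √(uniformPartition k).mesh) atTop (𝓝 0) := by
      simpa using tendsto_sqrt_mesh_uniformPartition.const_mul C
    filter_upwards [h1.eventually (gt_mem_nhds hε)] with k hk p hp
    rw [dist_comm, Real.dist_eq]
    exact (h _ x y (le_max_left _ _) (le_max_right _ _) _ hp.1 _ hp.2).trans_lt hk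
  exact hu.continuousOn (Frequently.of_forall fun k => continuousOn_interpKernel hlin hac _ x y)

/-- A family with admissible covariance matrices and continuous members has continuous
coefficients. -/
lemma continuousOn_coeff (hlin : LinearlyBounded φ) (hac : ACWithExpBoundedDeriv φ) (hσa : 0 < σa)
    {K : SobolevPath d → SobolevPath d → ℝ → ℝ → ℝ} (x y : SobolevPath d) {R : ℝ}
    (hK : ∀ x y, ContinuousOn (fun p : ℝ × ℝ => K x y p.1 p.2) (Icc 0 1 ×ˢ Icc 0 1))
    (hadm : ∀ s ∈ Icc (0 : ℝ) 1, ∀ t ∈ Icc (0 : ℝ) 1, AdmissibleAt σa K x y s t)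
    (hx : ∀ s ∈ Icc (0 : ℝ) 1, K x x s s ≤ R) (hy : ∀ s ∈ Icc (0 : ℝ) 1, K y y s s ≤ R) :
    ContinuousOn (fun p : ℝ × ℝ => coeff φ σA σb K x y p.1 p.2) (Icc 0 1 ×ˢ Icc 0 1) := by
  obtain ⟨L, hL, h⟩ := exists_abs_coeff_sub_le (d := d) hlin hac hσa σA σb R
  have hdx : ContinuousOn (fun p : ℝ × ℝ => K x x p.1 p.1) (Icc 0 1 ×ˢ Icc 0 1) :=
    (hK x x).comp (f := fun p : ℝ × ℝ => (p.1, p.1)) (by fun_prop) fun p hp => ⟨hp.1, hp.1⟩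
  have hdy : ContinuousOn (fun p : ℝ × ℝ => K y y p.2 p.2) (Icc 0 1 ×ˢ Icc 0 1) :=
    (hK y y).comp (f := fun p : ℝ × ℝ => (p.2, p.2)) (by fun_prop) fun p hp => ⟨hp.2, hp.2⟩
  intro p hp
  rw [ContinuousWithinAt, tendsto_iff_norm_sub_tendsto_zero]
  have hc : Tendsto (fun q : ℝ × ℝ => L * (|K x x q.1 q.1 - K x x p.1 p.1|
      + |K y y q.2 q.2 - K y y p.2 p.2| + |K x y q.1 q.2 - K x y p.1 p.2|))
      (𝓝[Icc 0 1 ×ˢ Icc 0 1] p) (𝓝 0) := by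
    have h1 := (tendsto_iff_norm_sub_tendsto_zero.1 (hdx p hp)).add
      (tendsto_iff_norm_sub_tendsto_zero.1 (hdy p hp)) |>.add
      (tendsto_iff_norm_sub_tendsto_zero.1 (hK x y p hp)) |>.const_mul L
    simpa using h1
  refine squeeze_zero' (Eventually.of_forall fun _ => norm_nonneg _) ?_ hc
  filter_upwards [self_mem_nhdsWithin] with q hq
  exact h K K x y _ _ _ _ (hadm _ hq.1 _ hq.2) (hadm _ hp.1 _ hp.2) (hx _ hq.1) (hy _ hq.2)
    (hx _ hp.1) (hy _ hp.2)

lemma BoundedMeasurable.of_continuousOn {w : ℝ → ℝ → ℝ}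
    (h : ContinuousOn (fun p : ℝ × ℝ => w p.1 p.2) (Icc 0 1 ×ˢ Icc 0 1)) :
    ∃ c, BoundedMeasurable w c := by
  obtain ⟨c, hc⟩ := (isCompact_Icc.prod isCompact_Icc).exists_bound_of_continuousOn h
  refine ⟨c, ?_, fun η hη τ hτ => hc (η, τ) ⟨hη, hτ⟩⟩
  rw [Measure.prod_restrict]
  exact h.aestronglyMeasurable (measurableSet_Icc.prod measurableSet_Icc)

lemma continuousOn_coeff_limitKernel (hlin : LinearlyBounded φ) (hac : ACWithExpBoundedDeriv φ)
    (hσa : 0 < σa) (x y : SobolevPath d) :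
    ContinuousOn (fun p : ℝ × ℝ => coeff φ σA σb (limitKernel φ σa σA σb) x y p.1 p.2)
      (Icc 0 1 ×ˢ Icc 0 1) := by
  obtain ⟨R, hR⟩ := exists_limitKernel_le (d := d) σA σb hlin hac hσa (max ‖x‖ ‖y‖)
  exact continuousOn_coeff σA σb hlin hac hσa x y
    (fun x y => continuousOn_limitKernel σA σb hlin hac hσa x y)
    (fun s hs t ht => admissibleAt_limitKernel σA σb hlin hac hσa x y hs ht)
    (hR x (le_max_left _ _)) (hR y (le_max_right _ _))

/-- The integrated Goursat equation, by passing to the limit in the definition of the interpolated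
kernels. -/
theorem limitKernel_eq (hlin : LinearlyBounded φ) (hac : ACWithExpBoundedDeriv φ)
    (hσa : 0 < σa) (x y : SobolevPath d) {s t : ℝ} (hs : s ∈ Icc (0 : ℝ) 1)
    (ht : t ∈ Icc (0 : ℝ) 1) :
    limitKernel φ σa σA σb x y s t =
      σa ^ 2 + pairIntegral (coeff φ σA σb (limitKernel φ σa σA σb) x y) x y s t := by
  set r := max ‖x‖ ‖y‖
  have hx : ‖x‖ ≤ r := le_max_left _ _
  have hy : ‖y‖ ≤ r := le_max_right _ _
  obtain ⟨C, hC, hstep⟩ := exists_abs_stepKernel_sub_limitKernel_le (d := d) σA σb hlin hac hσa r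
  obtain ⟨R, c, hR, hc, hSR, hbm⟩ := exists_boundedMeasurable_coeff (d := d) hlin hac σa σA σb r
  obtain ⟨R', hKR⟩ := exists_limitKernel_le (d := d) σA σb hlin hac hσa r
  obtain ⟨L, hL, hcoeff⟩ := exists_abs_coeff_sub_le (d := d) hlin hac hσa σA σb (max R R')
  obtain ⟨c', hbm'⟩ := BoundedMeasurable.of_continuousOn
    (continuousOn_coeff_limitKernel σA σb hlin hac hσa x y)
  have h1 := tendsto_limitKernel σA σb hlin hac hσa x y hs ht
  refine tendsto_nhds_unique h1 ?_
  simp_rw [interpKernel_eq]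
  refine Tendsto.const_add _ ?_
  rw [tendsto_iff_norm_sub_tendsto_zero]
  have h2 : Tendsto (fun k => ‖x‖ * ‖y‖ * (L * (3 * (C * √(uniformPartition k).mesh)) +
      0 * ((Real.exp (1 * s) + Real.exp (1 * t)) / √(2 * 1)))) atTop (𝓝 0) := by
    have := (((tendsto_sqrt_mesh_uniformPartition.const_mul C).const_mul 3).const_mul L).const_mul
      (‖x‖ * ‖y‖)
    simpa using this
  refine squeeze_zero (fun _ => norm_nonneg _) (fun k => ?_) h2
  rw [pairIntegral_sub x y (hbm _ x y hx hy) hbm' hs ht]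
  refine abs_pairIntegral_le x y (by positivity) le_rfl one_pos (fun η hη τ hτ => ?_) hs ht
  refine (hcoeff _ _ x y η τ η τ (admissibleAt_stepKernel hlin hac _ x y η τ)
    (admissibleAt_limitKernel σA σb hlin hac hσa x y hη hτ)
    ((hSR _ x hx η hη).trans (le_max_left _ _)) ((hSR _ y hy τ hτ).trans (le_max_left _ _))
    ((hKR x hx η hη).trans (le_max_right _ _)) ((hKR y hy τ hτ).trans (le_max_right _ _))).trans ?_
  rw [zero_mul, add_zero]
  refine mul_le_mul_of_nonneg_left ?_ hL
  have e1 := hstep (uniformPartition k) x x hx hx η hη η hη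
  have e2 := hstep (uniformPartition k) y y hy hy τ hτ τ hτ
  have e3 := hstep (uniformPartition k) x y hx hy η hη τ hτ
  linarith

end Limit

/-! ### The mixed derivative -/

section Differentiation
variable {E F : Type*} [NormedAddCommGroup E] [NormedSpace ℝ E] [NormedAddCommGroup F]
  [NormedSpace ℝ F]

lemma integrable_clm_apply {T : ℝ → E →L[ℝ] F} (hT : ContinuousOn T (Icc 0 1)) {f : ℝ → E}
    (hf : Integrable f unitVol) : Integrable (fun τ => T τ (f τ)) unitVol := by
  obtain ⟨C, hC⟩ := isCompact_Icc.exists_bound_of_continuousOn hT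
  refine (hf.norm.const_mul C).mono'
    ((ContinuousLinearMap.id ℝ (E →L[ℝ] F)).aestronglyMeasurable_comp₂
    (hT.aestronglyMeasurable measurableSet_Icc) hf.aestronglyMeasurable)
    ((ae_restrict_iff' measurableSet_Icc).2 (Eventually.of_forall fun τ hτ => ?_))
  exact (T τ).le_of_opNorm_le (hC τ hτ) _

/-- A point at which the primitives of `f` and of `‖f‖` are differentiable is good for all
primitives of `T f` with `T` continuous. The exceptional null set thus does not depend on `T`. -/
lemma hasDerivAt_integral_clm_apply [CompleteSpace E] [CompleteSpace F] {T : ℝ → E →L[ℝ] F}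
    (hT : ContinuousOn T (Icc 0 1)) {f : ℝ → E} (hf : Integrable f unitVol) {t : ℝ}
    (ht : t ∈ Ioo (0 : ℝ) 1) (h : HasDerivAt (fun u => ∫ τ in (0 : ℝ)..u, f τ) (f t) t)
    (hn : HasDerivAt (fun u => ∫ τ in (0 : ℝ)..u, ‖f τ‖) ‖f t‖ t) :
    HasDerivAt (fun u => ∫ τ in (0 : ℝ)..u, T τ (f τ)) (T t (f t)) t := by
  have h0 : (0 : ℝ) ∈ Icc (0 : ℝ) 1 := by simp
  have htI : t ∈ Icc (0 : ℝ) 1 := Ioo_subset_Icc_self ht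
  have hnh : Icc (0 : ℝ) 1 ∈ 𝓝 t := Icc_mem_nhds ht.1 ht.2
  have hR := integrable_clm_apply (hT.sub continuousOn_const) hf (T := fun τ => T τ - T t)
  have hmain : HasDerivAt (fun u => T t (∫ τ in (0 : ℝ)..u, f τ)) (T t (f t)) t :=
    (T t).hasFDerivAt.comp_hasDerivAt t h
  -- Near `t` the remainder is `ε` times an increment of `∫ ‖f‖`, hence `o(u - t)`.
  have hrem : HasDerivAt (fun u => ∫ τ in (0 : ℝ)..u, (T τ - T t) (f τ)) 0 t := by
    rw [hasDerivAt_iff_isLittleO]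
    refine Asymptotics.IsLittleO.trans_isBigO ?_ hn.isBigO_sub
    rw [Asymptotics.isLittleO_iff]
    intro ε hε
    have hcont : ContinuousAt T t := hT.continuousAt hnh
    obtain ⟨δ, hδ, hball⟩ := Metric.continuousAt_iff.1 hcont ε hε
    filter_upwards [hnh, Metric.ball_mem_nhds t hδ] with u hu hud
    rw [smul_zero, sub_zero, intervalIntegral.integral_interval_sub_left
      (intervalIntegrable_of_unitVol hR h0 hu) (intervalIntegrable_of_unitVol hR h0 htI),
      intervalIntegral.integral_interval_sub_left
      (intervalIntegrable_of_unitVol hf.norm h0 hu) (intervalIntegrable_of_unitVol hf.norm h0 htI),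
      Real.norm_eq_abs, ← abs_of_pos hε, ← abs_mul, ← intervalIntegral.integral_const_mul]
    refine intervalIntegral.norm_integral_le_abs_of_norm_le
      ((ae_restrict_iff' measurableSet_uIoc).2 (Eventually.of_forall fun τ hτ => ?_))
      ((intervalIntegrable_of_unitVol hf.norm htI hu).const_mul ε)
    refine (T τ - T t).le_of_opNorm_le ?_ _
    rw [← dist_eq_norm]
    refine (hball ?_).le
    rw [Real.dist_eq]
    refine (abs_sub_left_of_mem_uIcc (uIoc_subset_uIcc hτ)).trans_lt ?_
    rwa [Metric.mem_ball, Real.dist_eq] at hud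
  have hsum := hmain.add hrem
  rw [add_zero] at hsum
  refine hsum.congr_of_eventuallyEq ?_
  filter_upwards [hnh] with u hu
  rw [Pi.add_apply, ← ContinuousLinearMap.intervalIntegral_comp_comm _
    (intervalIntegrable_of_unitVol hf h0 hu),
    ← intervalIntegral.integral_add (intervalIntegrable_of_unitVol
      (integrable_clm_apply (T := fun _ => T t) continuousOn_const hf) h0 hu)
      (intervalIntegrable_of_unitVol hR h0 hu)]
  simp

lemma ae_hasDerivAt_of_unitVol [CompleteSpace E] {f : ℝ → E} (hf : Integrable f unitVol) :
    ∀ᵐ t ∂unitVol, t ∈ Ioo (0 : ℝ) 1 ∧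
      HasDerivAt (fun u => ∫ τ in (0 : ℝ)..u, f τ) (f t) t ∧
      HasDerivAt (fun u => ∫ τ in (0 : ℝ)..u, ‖f τ‖) ‖f t‖ t := by
  have h0 : (0 : ℝ) ∈ Icc (0 : ℝ) 1 := by simp
  have h1 : (1 : ℝ) ∈ Icc (0 : ℝ) 1 := by simp
  rw [ae_restrict_iff' measurableSet_Icc]
  have e0 : ∀ᵐ τ : ℝ, τ ≠ 0 := compl_mem_ae_iff.2 (measure_singleton _)
  have e1 : ∀ᵐ τ : ℝ, τ ≠ 1 := compl_mem_ae_iff.2 (measure_singleton _)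
  filter_upwards [(intervalIntegrable_of_unitVol hf h0 h1).ae_hasDerivAt_integral,
    (intervalIntegrable_of_unitVol hf.norm h0 h1).ae_hasDerivAt_integral, e0, e1]
    with t ht ht' hne0 hne1 hmem
  rw [uIcc_of_le zero_le_one] at ht ht'
  exact ⟨⟨lt_of_le_of_ne hmem.1 hne0.symm, lt_of_le_of_ne hmem.2 hne1⟩, ht hmem 0 h0,
    ht' hmem 0 h0⟩

end Differentiation

section Mixed
variable {d : ℕ} {w : ℝ → ℝ → ℝ} (x y : SobolevPath d)

lemma continuousOn_integral_smul_velocity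
    (hw : ContinuousOn (fun p : ℝ × ℝ => w p.1 p.2) (Icc 0 1 ×ˢ Icc 0 1)) {s : ℝ}
    (hs : s ∈ Icc (0 : ℝ) 1) :
    ContinuousOn (fun τ => ∫ η in (0 : ℝ)..s, w η τ • x.velocity η) (Icc 0 1) := by
  obtain ⟨c, hc⟩ := (isCompact_Icc.prod isCompact_Icc).exists_bound_of_continuousOn hw
  have hsub := Ioc_subset_Icc_unit (a := 0) (by simp) hs
  have hle : volume.restrict (Ioc 0 s) ≤ unitVol := Measure.restrict_mono hsub le_rfl
  have hx := (integrable_velocity x).mono_measure hle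
  simp_rw [intervalIntegral.integral_of_le hs.1]
  refine continuousOn_of_dominated (bound := fun η => c * ‖x.velocity η‖) (fun τ hτ => ?_)
    (fun τ hτ => ?_) (hx.norm.const_mul c) ?_
  · have h : ContinuousOn (fun η => w η τ) (Ioc 0 s) :=
      hw.comp (f := fun η => (η, τ)) (by fun_prop) fun η hη => ⟨hsub hη, hτ⟩
    exact (h.aestronglyMeasurable measurableSet_Ioc).smul hx.aestronglyMeasurable
  · refine (ae_restrict_iff' measurableSet_Ioc).2 (Eventually.of_forall fun η hη => ?_)
    rw [norm_smul]
    gcongr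
    exact hc (η, τ) ⟨hsub hη, hτ⟩
  · refine (ae_restrict_iff' measurableSet_Ioc).2 (Eventually.of_forall fun η hη => ?_)
    have h : ContinuousOn (fun τ => w η τ) (Icc 0 1) :=
      hw.comp (f := fun τ => (η, τ)) (by fun_prop) fun τ hτ => ⟨hsub hη, hτ⟩
    exact h.smul continuousOn_const

/-- By Fubini's theorem, the double integral is a primitive in its second endpoint. -/
lemma pairIntegral_eq_integral_inner {c : ℝ} (hw : BoundedMeasurable w c)
    (hwc : ContinuousOn (fun p : ℝ × ℝ => w p.1 p.2) (Icc 0 1 ×ˢ Icc 0 1)) {s t : ℝ}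
    (hs : s ∈ Icc (0 : ℝ) 1) (ht : t ∈ Icc (0 : ℝ) 1) :
    pairIntegral w x y s t = ∫ τ in (0 : ℝ)..t,
      innerSL ℝ (∫ η in (0 : ℝ)..s, w η τ • x.velocity η) (y.velocity τ) := by
  have hsub := Ioc_subset_Icc_unit (a := 0) (by simp) hs
  have hsub' := Ioc_subset_Icc_unit (a := 0) (by simp) ht
  have h : Integrable (fun p : ℝ × ℝ => w p.1 p.2 * inner ℝ (x.velocity p.1) (y.velocity p.2))
      ((volume.restrict (Ioc 0 s)).prod (volume.restrict (Ioc 0 t))) := by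
    refine (hw.integrable x y).mono_measure ?_
    rw [Measure.prod_restrict, Measure.prod_restrict]
    exact Measure.restrict_mono (prod_mono hsub hsub') le_rfl
  rw [pairIntegral]
  simp_rw [intervalIntegral.integral_of_le hs.1, intervalIntegral.integral_of_le ht.1]
  rw [integral_integral_swap h]
  refine setIntegral_congr_fun measurableSet_Ioc fun τ hτ => ?_
  rw [innerSL_apply_apply, real_inner_comm, ← innerSL_apply_apply ℝ,
    ← ContinuousLinearMap.integral_comp_comm]
  · refine integral_congr_ae (Eventually.of_forall fun η => ?_)
    simp [real_inner_comm]
  · have hT : ContinuousOn (fun η => w η τ • ContinuousLinearMap.id ℝ (EuclideanSpace ℝ (Fin d)))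
        (Icc 0 1) := by
      have h : ContinuousOn (fun η => w η τ) (Icc 0 1) :=
        hwc.comp (f := fun η => (η, τ)) (by fun_prop) fun η hη => ⟨hη, hsub' hτ⟩
      exact h.smul continuousOn_const
    simpa using (integrable_clm_apply hT (integrable_velocity x)).mono_measure
      (Measure.restrict_mono hsub le_rfl)

/-- The mixed derivative of `∫_0^s ∫_0^t w ⟨x', y'⟩` for continuous `w` is `w ⟨x', y'⟩` almost
everywhere. -/
theorem exists_hasDerivAt_pairIntegral
    (hw : ContinuousOn (fun p : ℝ × ℝ => w p.1 p.2) (Icc 0 1 ×ˢ Icc 0 1)) :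
    ∃ L : ℝ → ℝ → ℝ,
      (∀ᵐ t ∂unitVol, t ∈ Ioo (0 : ℝ) 1 ∧
        ∀ s ∈ Icc (0 : ℝ) 1, HasDerivAt (fun τ => pairIntegral w x y s τ) (L s t) t) ∧
      (∀ᵐ t ∂unitVol, ∀ᵐ s ∂unitVol,
        HasDerivAt (fun η => L η t) (w s t * inner ℝ (x.velocity s) (y.velocity t)) s) := by
  obtain ⟨c, hc⟩ := BoundedMeasurable.of_continuousOn hw
  refine ⟨fun s t => innerSL ℝ (∫ η in (0 : ℝ)..s, w η t • x.velocity η) (y.velocity t), ?_, ?_⟩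
  · filter_upwards [ae_hasDerivAt_of_unitVol (integrable_velocity y)] with t ht
    refine ⟨ht.1, fun s hs => ?_⟩
    have hT : ContinuousOn (fun τ => innerSL ℝ (∫ η in (0 : ℝ)..s, w η τ • x.velocity η))
        (Icc 0 1) := (innerSL ℝ).continuous.comp_continuousOn
          (continuousOn_integral_smul_velocity x hw hs)
    refine (hasDerivAt_integral_clm_apply hT (integrable_velocity y) ht.1 ht.2.1
      ht.2.2).congr_of_eventuallyEq ?_
    filter_upwards [Icc_mem_nhds ht.1.1 ht.1.2] with u hu
    exact pairIntegral_eq_integral_inner x y hc hw hs hu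
  · refine (ae_restrict_iff' measurableSet_Icc).2 (Eventually.of_forall fun t ht => ?_)
    filter_upwards [ae_hasDerivAt_of_unitVol (integrable_velocity x)] with s hs
    have hT : ContinuousOn (fun η => w η t • ContinuousLinearMap.id ℝ (EuclideanSpace ℝ (Fin d)))
        (Icc 0 1) := by
      have h : ContinuousOn (fun η => w η t) (Icc 0 1) :=
        hw.comp (f := fun η => (η, t)) (by fun_prop) fun η hη => ⟨hη, ht⟩
      exact h.smul continuousOn_const
    have h1 := hasDerivAt_integral_clm_apply hT (integrable_velocity x) hs.1 hs.2.1 hs.2.2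
    have h2 := (innerSL ℝ (y.velocity t)).hasFDerivAt.comp_hasDerivAt s h1
    rw [show w s t * inner ℝ (x.velocity s) (y.velocity t) = innerSL ℝ (y.velocity t)
      ((w s t • ContinuousLinearMap.id ℝ (EuclideanSpace ℝ (Fin d))) (x.velocity s)) by
      simp [real_inner_comm]]
    refine h2.congr_of_eventuallyEq (Eventually.of_forall fun u => ?_)
    simp [real_inner_comm]

end Mixed

end NeuralSigKernel

open NeuralSigKernel in
theorem mainTheorem3 (d : ℕ) (φ : ℝ → ℝ) (hlin : LinearlyBounded φ)
    (hac : ACWithExpBoundedDeriv φ) (σa σA σb : ℝ) (hσa : 0 < σa) (hσA : 0 < σA) (hσb : 0 ≤ σb) :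
    ∃ K : SobolevPath d → SobolevPath d → ℝ → ℝ → ℝ,
      (∀ x y, SolvesGoursat φ σa σA σb K x y) ∧
      (∀ (D : UnitPartition) (x y : SobolevPath d),
        ContinuousOn (fun p : ℝ × ℝ => interpKernel φ σa σA σb D x y p.1 p.2)
          (Icc 0 1 ×ˢ Icc 0 1)) ∧
      (∀ D : ℕ → UnitPartition, Tendsto (fun M => (D M).mesh) atTop (𝓝 0) →
        (∀ x y, TendstoUniformlyOn
          (fun M (p : ℝ × ℝ) => interpKernel φ σa σA σb (D M) x y p.1 p.2)
          (fun p => K x y p.1 p.2) atTop (Icc 0 1 ×ˢ Icc 0 1)) ∧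
        (∀ r : ℝ, TendstoUniformlyOn
          (fun M (q : (SobolevPath d × SobolevPath d) × ℝ × ℝ) =>
            interpKernel φ σa σA σb (D M) q.1.1 q.1.2 q.2.1 q.2.2)
          (fun q => K q.1.1 q.1.2 q.2.1 q.2.2) atTop
          ({xy | ‖xy.1‖ ≤ r ∧ ‖xy.2‖ ≤ r} ×ˢ (Icc 0 1 ×ˢ Icc 0 1)))) ∧
      (∀ r : ℝ, ∃ C : ℝ, ∀ (D : UnitPartition) (x y : SobolevPath d),
        ‖x‖ ≤ r → ‖y‖ ≤ r → ∀ s ∈ Icc (0 : ℝ) 1, ∀ t ∈ Icc (0 : ℝ) 1,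
          |interpKernel φ σa σA σb D x y s t - K x y s t| ≤ C * √D.mesh) := by
  have hrate := fun r => exists_abs_interpKernel_sub_limitKernel_le (d := d) σA σb hlin hac hσa r
  have hunif : ∀ D : ℕ → UnitPartition, Tendsto (fun M => (D M).mesh) atTop (𝓝 0) → ∀ r : ℝ,
      TendstoUniformlyOn (fun M (q : (SobolevPath d × SobolevPath d) × ℝ × ℝ) =>
          interpKernel φ σa σA σb (D M) q.1.1 q.1.2 q.2.1 q.2.2)
        (fun q => limitKernel φ σa σA σb q.1.1 q.1.2 q.2.1 q.2.2) atTop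
        ({xy | ‖xy.1‖ ≤ r ∧ ‖xy.2‖ ≤ r} ×ˢ (Icc 0 1 ×ˢ Icc 0 1)) := by
    intro D hD r
    obtain ⟨C, -, h⟩ := hrate r
    rw [Metric.tendstoUniformlyOn_iff]
    intro ε hε
    have h1 : Tendsto (fun M => C * √(D M).mesh) atTop (𝓝 0) := by
      simpa using hD.sqrt.const_mul C
    filter_upwards [h1.eventually (gt_mem_nhds hε)] with M hM q hq
    rw [dist_comm, Real.dist_eq]
    exact (h _ _ _ hq.1.1 hq.1.2 _ hq.2.1 _ hq.2.2).trans_lt hM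
  refine ⟨limitKernel φ σa σA σb, fun x y => ?_,
    fun D x y => continuousOn_interpKernel hlin hac D x y,
    fun D hD => ⟨fun x y => ?_, hunif D hD⟩, fun r => ?_⟩
  · have heq := fun s hs t ht => limitKernel_eq (s := s) (t := t) σA σb hlin hac hσa x y hs ht
    have hco := continuousOn_coeff_limitKernel σA σb hlin hac hσa x y
    obtain ⟨c, hc⟩ := BoundedMeasurable.of_continuousOn hco
    have h0 : (0 : ℝ) ∈ Icc (0 : ℝ) 1 := by simp
    refine ⟨continuousOn_limitKernel σA σb hlin hac hσa x y, fun s hs t ht =>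
      (admissibleAt_limitKernel σA σb hlin hac hσa x y hs ht).posSemidef, fun t ht => ?_,
      fun s hs => ?_, hc.integrable x y, heq, ?_⟩
    · simp [heq 0 h0 t ht, pairIntegral]
    · simp [heq s hs 0 h0, pairIntegral]
    · obtain ⟨L, hL1, hL2⟩ := exists_hasDerivAt_pairIntegral x y hco
      refine ⟨L, ?_, hL2⟩
      filter_upwards [hL1] with t ht s hs
      refine ((ht.2 s hs).const_add (σa ^ 2)).congr_of_eventuallyEq ?_
      filter_upwards [Icc_mem_nhds ht.1.1 ht.1.2] with u hu
      exact heq s hs u hu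
  · have h := (hunif D hD (max ‖x‖ ‖y‖)).comp fun p : ℝ × ℝ => ((x, y), p)
    exact h.mono fun p hp => ⟨⟨le_max_left _ _, le_max_right _ _⟩, hp⟩
  · obtain ⟨C, -, h⟩ := hrate r
    exact ⟨C, h⟩
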